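/- Let $M$ be a compact bordered Riemann surface with a smooth metric $g$ in its conformal class, and let $M^D=M\cup M'$ be its double: the closed Riemann surface obtained by gluing $M$ along $\partial M$ to a copy $M'$ of $M$ carrying the complex conjugate complex structure. Let $R:M^D\to M^D$ be the anticonformal involution that exchanges $M$ and $M'$ and fixes $\partial M$ pointwise. Assume that $g$ extends to a smooth metric on $M^D$, again denoted $g$, with $R^*g=g$; this is the case for instance when $(M,g)$ is isometric to a flat cylinder $([0,\epsilon]\times S^1,dt^2+d\theta^2)$ near each component of $\partial M$. Integrals and lengths of differentials are taken with respect to $g$. For $h>0$ and $D=M$ or $D=M^D$ put $$\|v\|_{H^1_{scl}(D)}^2=\int_D|v|^2+h^2\int_D|dv|_g^2 .$$ Let $H^1(M^D)$ be the completion of $C^\infty(M^D)$ and $H^1_0(M)$ the completion of the smooth functions with compact support in the interior of $M$, for these norms, and put $$\|u\|_{H^{-1}_{scl}(M^D)}=\sup\Big\{\Big|\int_{M^D}uv\Big| : v\in H^1(M^D),\ \|v\|_{H^1_{scl}(M^D)}\le 1\Big\},$$ $$\|u\|_{H^{-1}_{scl}(M)}=\sup\Big\{\Big|\int_{M}uv\Big|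 : v\in H^1_0(M),\ \|v\|_{H^1_{scl}(M)}\le 1\Big\}.$$ All functions are real valued, or all are complex valued. If $\tilde u\in C^\infty(M^D)$ is odd under $R$, that is $R^*\tilde u=-\tilde u$, then for every $h>0$ these norms of $\tilde u$ are finite and $$\|\tilde u\|_{H^{-1}_{scl}(M^D)}=\sqrt2\,\|\tilde u\|_{H^{-1}_{scl}(M)} .$$ -/

import Mathlib

open MeasureTheory Filter Topology Bundle
open scoped Manifold ContDiff

noncomputable section

namespace DoubledSurface

/-- A holomorphic atlas is in particular a smooth real atlas. -/
instance instIsManifoldReal {X : Type*} [TopologicalSpace X] [ChartedSpace ℂ X]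
    [IsManifold 𝓘(ℂ, ℂ) ω X] : IsManifold 𝓘(ℝ, ℂ) ∞ X := by
  apply isManifold_of_contDiffOn
  intro e e' he he'
  have h1 := (contDiffGroupoid ω 𝓘(ℂ, ℂ)).compatible he he'
  exact (h1.1.restrict_scalars ℝ).of_le le_top

/-! ### Riemann surfaces with a metric -/

instance instFiniteDimensionalTangentSpace {X : Type*} [TopologicalSpace X] [ChartedSpace ℂ X]
    (x : X) : FiniteDimensional ℝ (TangentSpace 𝓘(ℝ, ℂ) x) :=
  inferInstanceAs (FiniteDimensional ℝ ℂ)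

/-- Multiplication by `i` on the tangent space at `x` of a Riemann surface. (The identification of
the tangent space with `ℂ` is through the preferred chart at `x`, which is holomorphic.) -/
def tangentI {X : Type*} [TopologicalSpace X] [ChartedSpace ℂ X] (x : X)
    (v : TangentSpace 𝓘(ℝ, ℂ) x) : TangentSpace 𝓘(ℝ, ℂ) x :=
  (Complex.I * (show ℂ from v) : ℂ)

section

variable (X : Type*) [TopologicalSpace X] [ChartedSpace ℂ X]
  [RiemannianBundle (fun x : X => TangentSpace 𝓘(ℝ, ℂ) x)]

/-- The metric belongs to the conformal class of the complex structure:
multiplication by `i` is orthogonal on each tangent space. -/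
def IsConformalMetric : Prop :=
  ∀ (x : X) (v w : TangentSpace 𝓘(ℝ, ℂ) x),
    inner ℝ (tangentI x v) (tangentI x w) = inner ℝ v w

variable {X}

/-- The coordinate vector field `∂_v` (`v = 1` or `v = i`) of the chart at `p`, at the point with
coordinate `z`. -/
def coordVec (p : X) (z : ℂ) (v : ℂ) :
    TangentSpace 𝓘(ℝ, ℂ) ((chartAt ℂ p).symm z) :=
  mfderiv 𝓘(ℝ, ℂ) 𝓘(ℝ, ℂ) (chartAt ℂ p).symm z v

/-- The density `√(det (g_ij))` of the metric in the chart at `p`. -/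
def chartDensity (p : X) (z : ℂ) : ℝ :=
  √(inner ℝ (coordVec p z 1) (coordVec p z 1)
      * inner ℝ (coordVec p z Complex.I) (coordVec p z Complex.I)
    - inner ℝ (coordVec p z 1) (coordVec p z Complex.I) ^ 2)

/-- The measure `√(det (g_ij)) dx dy` of the chart at `p`, carried to the surface. -/
def chartVolume [MeasurableSpace X] (p : X) : Measure X :=
  ((volume.restrict (chartAt ℂ p).target).withDensity
    (fun z => ENNReal.ofReal (chartDensity p z))).map (chartAt ℂ p).symm

variable (X) in
/-- The Riemannian volume measure: the least measure which dominates `√(det (g_ij)) dx dy` in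
every chart. (The chart measures agree on overlaps, so on the domain of each chart this measure
is equal to the chart measure.) -/
def riemannianVolume [MeasurableSpace X] : Measure X :=
  ⨆ p : X, chartVolume p

/-! ### Sobolev norms -/

variable {𝕜 : Type*} [RCLike 𝕜]

/-- The differential of a function at `x`, as a function on the tangent space. -/
def differential (φ : X → 𝕜) (x : X) (v : TangentSpace 𝓘(ℝ, ℂ) x) : 𝕜 :=
  mfderiv 𝓘(ℝ, ℂ) 𝓘(ℝ, 𝕜) φ x v

/-- The squared length `|dφ|²_g` at `x`, computed in an orthonormal basis of the tangent space. -/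
def normSqDifferential (φ : X → 𝕜) (x : X) : ℝ :=
  ∑ i, ‖differential φ x (stdOrthonormalBasis ℝ (TangentSpace 𝓘(ℝ, ℂ) x) i)‖ ^ 2

variable [MeasurableSpace X]

/-- The semiclassical norm `‖φ‖_{H¹_scl(D)} = (∫_D |φ|² + h² |dφ|²)^{1/2}` of a smooth function. -/
def smoothH1Norm (h : ℝ) (D : Set X) (φ : X → 𝕜) : ℝ :=
  √(∫ x in D, (‖φ x‖ ^ 2 + h ^ 2 * normSqDifferential φ x) ∂(riemannianVolume X))

/-- `HasH1Norm 𝒜 h D v N`: the function `v ∈ L²(D)` belongs to the completion of the space `𝒜` of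
smooth functions in the norm `‖·‖_{H¹_scl(D)}`, and its norm there is `N`. That is, `v` is the
`L²(D)` limit of a sequence in `𝒜` which is Cauchy in `H¹_scl(D)`, and `N` is the limit of the
norms. -/
def HasH1Norm (𝒜 : Set (X → 𝕜)) (h : ℝ) (D : Set X) (v : X → 𝕜) (N : ℝ) : Prop :=
  MemLp v 2 ((riemannianVolume X).restrict D) ∧
  ∃ φ : ℕ → X → 𝕜, (∀ n, φ n ∈ 𝒜) ∧
    Tendsto (fun n => eLpNorm (φ n - v) 2 ((riemannianVolume X).restrict D)) atTop (𝓝 0) ∧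
    Tendsto (fun mn : ℕ × ℕ => smoothH1Norm h D (φ mn.1 - φ mn.2)) atTop (𝓝 0) ∧
    Tendsto (fun n => smoothH1Norm h D (φ n)) atTop (𝓝 N)

/-- The norm of `u`, as the functional `v ↦ ∫_D u v`, dual to the completion of `𝒜` in the norm
`‖·‖_{H¹_scl(D)}`: the supremum of `|∫_D u v|` over the unit ball of that completion. -/
def dualNorm (𝒜 : Set (X → 𝕜)) (h : ℝ) (D : Set X) (u : X → 𝕜) : ENNReal :=
  ⨆ (v : X → 𝕜) (N : ℝ) (_ : HasH1Norm 𝒜 h D v N) (_ : N ≤ 1),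
    ‖∫ x in D, u x * v x ∂(riemannianVolume X)‖ₑ

variable (X 𝕜) in
/-- The smooth functions on `X`. Their completion is `H¹(X)`, for `X` closed. -/
def smoothFunctions : Set (X → 𝕜) :=
  {φ | ContMDiff 𝓘(ℝ, ℂ) 𝓘(ℝ, 𝕜) ∞ φ}

variable (𝕜) in
/-- The smooth functions with compact support in the interior of `M`.
Their completion is `H¹₀(M)`. -/
def testFunctions (M : Set X) : Set (X → 𝕜) :=
  {φ | ContMDiff 𝓘(ℝ, ℂ) 𝓘(ℝ, 𝕜) ∞ φ ∧ HasCompactSupport φ ∧ tsupport φ ⊆ interior M}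

/-- The norm of `H⁻¹_scl(X)` for a closed surface `X`: the dual norm of `H¹_scl(X)`. -/
def closedHNegOneNorm (h : ℝ) (u : X → 𝕜) : ENNReal :=
  dualNorm (smoothFunctions X 𝕜) h Set.univ u

/-- The norm of `H⁻¹_scl(M)` for a surface `M` with boundary: the dual norm of `H¹₀(M)` with the
norm of `H¹_scl(M)`. Only the values of `u` on `M` matter. -/
def borderedHNegOneNorm (h : ℝ) (M : Set X) (u : X → 𝕜) : ENNReal :=
  dualNorm (testFunctions 𝕜 M) h M u

end

/-! ### Doubles -/

/-- The closed Riemann surface `X` with its metric is the double of the bordered surface `M ⊆ X`,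
and `R` is its reflection: `X` consists of `M` and of its copy `R(M)`, with the complex conjugate
complex structure and the same metric, glued along `∂M`; near a point of `∂M` the surface `X` has a
holomorphic coordinate in which `M` is the upper half plane and `R` is complex conjugation. -/
structure IsDouble {X : Type*} [TopologicalSpace X] [ChartedSpace ℂ X]
    [RiemannianBundle (fun x : X => TangentSpace 𝓘(ℝ, ℂ) x)]
    (M : Set X) (R : X → X) : Prop where
  isClosed : IsClosed M
  union_eq : M ∪ R '' M = Set.univ
  inter_eq : M ∩ R '' M = frontier M
  involutive : Function.Involutive R
  fixes_boundary : ∀ x ∈ frontier M, R x = x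
  smooth : ContMDiff 𝓘(ℝ, ℂ) 𝓘(ℝ, ℂ) ∞ R
  anticonformal : ∀ (x : X) (v : TangentSpace 𝓘(ℝ, ℂ) x),
    mfderiv 𝓘(ℝ, ℂ) 𝓘(ℝ, ℂ) R x (tangentI x v)
      = -tangentI (R x) (mfderiv 𝓘(ℝ, ℂ) 𝓘(ℝ, ℂ) R x v)
  isometric : ∀ (x : X) (v w : TangentSpace 𝓘(ℝ, ℂ) x),
    inner ℝ (mfderiv 𝓘(ℝ, ℂ) 𝓘(ℝ, ℂ) R x v) (mfderiv 𝓘(ℝ, ℂ) 𝓘(ℝ, ℂ) R x w) = inner ℝ v w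
  boundary_chart : ∀ p ∈ frontier M, ∃ e ∈ IsManifold.maximalAtlas 𝓘(ℂ, ℂ) ω X,
    p ∈ e.source ∧ ∀ x ∈ e.source,
      (x ∈ M ↔ 0 ≤ (e x).im) ∧ R x ∈ e.source ∧ e (R x) = (starRingEnd ℂ) (e x)

end DoubledSurface

end

noncomputable section

set_option linter.unusedSectionVars false

/-! One operator gives both inequalities: the normalized odd part `A f = (f - f ∘ R) / √2`, called
`oddPart`. Since `R` is an isometric involution, it preserves volume and energy, and for odd `u` one
has `∫_X u (A f) = √2 ∫_X u f` (`integral_mul_oddPart`).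

Upper bound: for `v` in `H¹(X)`, `A v` is odd, so it has zero trace on `∂M` and its restriction to
`M` lies in `H¹₀(M)`. Its energy on `M` is half of its energy on `X`, hence at most that of `v`; and
`∫_X u v = √2 ∫_M u (A v)`. This is `exists_hasH1Norm_oddPart`. Lower bound: for `w` in `H¹₀(M)`
extended by zero, `w` and `w ∘ R` live on complementary halves, so `A w` has on `X` exactly the norm
of `w` on `M`, and `∫_X u (A w) = √2 ∫_M u w`. This is `hasH1Norm_oddPart_indicator`.

The analytic input is that a smooth function vanishing on `∂M` is an `H¹(M)` limit of test functions
(`exists_testFunctions_tendsto`). It is proved by truncating values near zero, using that the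
differential vanishes almost everywhere on the zero set; no trace theory is needed. The geometric
input is that `R` preserves the volume (`map_riemannianVolume`) and that `∂M` is null
(`riemannianVolume_frontier`). -/

namespace DoubledSurface

/-! ### Gram determinants -/

/-- This is `|l|² = g^{ij} l_i l_j` cleared of its denominator, a polynomial identity in orthonormal
coordinates. It removes the arbitrary orthonormal basis from `normSqDifferential`. -/
theorem sum_norm_sq_mul_gram {𝕜 V : Type*} [RCLike 𝕜] [NormedAddCommGroup V]
    [InnerProductSpace ℝ V] [FiniteDimensional ℝ V] (hV : Module.finrank ℝ V = 2)
    (l : V →ₗ[ℝ] 𝕜) (b c : V) :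
    (∑ i, ‖l (stdOrthonormalBasis ℝ V i)‖ ^ 2)
        * (inner ℝ b b * inner ℝ c c - inner ℝ b c ^ 2)
      = inner ℝ c c * ‖l b‖ ^ 2 + inner ℝ b b * ‖l c‖ ^ 2
        - 2 * inner ℝ b c * (RCLike.re (l b) * RCLike.re (l c)
          + RCLike.im (l b) * RCLike.im (l c)) := by
  let e := (stdOrthonormalBasis ℝ V).reindex (finCongr hV)
  have hsum : (∑ i, ‖l (stdOrthonormalBasis ℝ V i)‖ ^ 2) = ∑ i, ‖l (e i)‖ ^ 2 := by
    rw [← (finCongr hV).sum_comp]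
    simp [e]
  have hexp (v : V) : l v = (inner ℝ (e 0) v : ℝ) • l (e 0) + (inner ℝ (e 1) v : ℝ) • l (e 1) := by
    conv_lhs => rw [← e.sum_repr' v]
    simp
  have hinner (v w : V) : inner ℝ v w
      = (inner ℝ (e 0) v : ℝ) * inner ℝ (e 0) w + (inner ℝ (e 1) v : ℝ) * inner ℝ (e 1) w := by
    rw [← e.sum_inner_mul_inner v w]
    simp [real_inner_comm]
  rw [hsum, hexp b, hexp c, hinner b b, hinner b c, hinner c c]
  simp only [Fin.sum_univ_two, ← RCLike.normSq_eq_def', RCLike.normSq_apply, map_add,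
    RCLike.smul_re, RCLike.smul_im]
  ring

/-- The images `A (e i)` have the same identity Gram matrix as the `e i`, so `sum_norm_sq_mul_gram`
evaluates both sides to the same expression. -/
theorem sum_norm_sq_comp_isometry {𝕜 V W : Type*} [RCLike 𝕜] [NormedAddCommGroup V]
    [InnerProductSpace ℝ V] [FiniteDimensional ℝ V] [NormedAddCommGroup W]
    [InnerProductSpace ℝ W] [FiniteDimensional ℝ W] (hV : Module.finrank ℝ V = 2)
    (hW : Module.finrank ℝ W = 2) (l : W →ₗ[ℝ] 𝕜) (A : V →ₗ[ℝ] W)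
    (hA : ∀ v w, inner ℝ (A v) (A w) = inner ℝ v w) :
    ∑ i, ‖l (A (stdOrthonormalBasis ℝ V i))‖ ^ 2 = ∑ i, ‖l (stdOrthonormalBasis ℝ W i)‖ ^ 2 := by
  let e := (stdOrthonormalBasis ℝ V).reindex (finCongr hV)
  have h00 : inner ℝ (e 0) (e 0) = 1 := by simp
  have h11 : inner ℝ (e 1) (e 1) = 1 := by simp
  have h01 : inner ℝ (e 0) (e 1) = 0 := e.orthonormal.2 (by simp)
  have h1 := sum_norm_sq_mul_gram hV (l.comp A) (e 0) (e 1)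
  have h2 := sum_norm_sq_mul_gram hW l (A (e 0)) (A (e 1))
  simp only [hA, h00, h11, h01] at h1 h2
  simp only [LinearMap.comp_apply] at h1
  linarith

theorem gram_pos {V : Type*} [NormedAddCommGroup V] [InnerProductSpace ℝ V] {b c : V}
    (h : ∀ s t : ℝ, s • b + t • c = 0 → s = 0 ∧ t = 0) :
    0 < inner ℝ b b * inner ℝ c c - inner ℝ b c ^ 2 := by
  have hb : (0 : ℝ) < inner ℝ b b := by
    refine lt_of_le_of_ne real_inner_self_nonneg fun h0 => ?_
    have := h 1 0 (by simpa using inner_self_eq_zero.1 h0.symm)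
    exact one_ne_zero this.1
  -- Up to the factor `⟨b, b⟩`, this is the component of `c` orthogonal to `b`; its squared length
  -- is `⟨b, b⟩` times the Gram determinant.
  set v := (-inner ℝ b c : ℝ) • b + (inner ℝ b b : ℝ) • c with hv
  have hv0 : v ≠ 0 := fun h0 => hb.ne' (h _ _ h0).2
  have hpos : (0 : ℝ) < inner ℝ v v :=
    lt_of_le_of_ne real_inner_self_nonneg fun h0 => hv0 (inner_self_eq_zero.1 h0.symm)
  have hexp : (inner ℝ v v : ℝ)
      = inner ℝ b b * (inner ℝ b b * inner ℝ c c - inner ℝ b c ^ 2) := by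
    simp only [hv, inner_add_left, inner_add_right, real_inner_smul_left, real_inner_smul_right,
      real_inner_comm b c]
    ring
  rw [hexp] at hpos
  exact pos_of_mul_pos_right hpos hb.le

theorem gram_comp {V : Type*} [NormedAddCommGroup V] [InnerProductSpace ℝ V]
    (c : ℂ →ₗ[ℝ] V) (T : ℂ →L[ℝ] ℂ) :
    inner ℝ (c (T 1)) (c (T 1)) * inner ℝ (c (T Complex.I)) (c (T Complex.I))
        - inner ℝ (c (T 1)) (c (T Complex.I)) ^ 2
      = T.det ^ 2 * (inner ℝ (c 1) (c 1) * inner ℝ (c Complex.I) (c Complex.I)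
        - inner ℝ (c 1) (c Complex.I) ^ 2) := by
  have hdet : T.det = (T 1).re * (T Complex.I).im - (T Complex.I).re * (T 1).im := by
    change LinearMap.det (T : ℂ →ₗ[ℝ] ℂ) = _
    rw [← LinearMap.det_toMatrix Complex.basisOneI, Matrix.det_fin_two]
    simp [LinearMap.toMatrix_apply]
  have hexp (z : ℂ) : c z = z.re • c 1 + z.im • c Complex.I := by
    rw [← map_smul, ← map_smul, ← map_add]
    congr 1
    apply Complex.ext <;> simp
  rw [hdet, hexp (T 1), hexp (T Complex.I)]
  simp only [inner_add_left, inner_add_right, real_inner_smul_left, real_inner_smul_right,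
      real_inner_comm (c 1) (c Complex.I)]
  ring

/-! ### The Riemannian volume -/

section Volume

variable {X : Type*} [TopologicalSpace X] [ChartedSpace ℂ X]

theorem measurableSet_target_inter_preimage {Y : Type*} [TopologicalSpace Y] [MeasurableSpace X]
    [BorelSpace X] [MeasurableSpace Y] [BorelSpace Y] (e : OpenPartialHomeomorph X Y) {A : Set X}
    (hA : MeasurableSet A) : MeasurableSet (e.target ∩ e.symm ⁻¹' A) := by
  have h1 : Measurable (e.target.domRestrict e.symm) :=
    (continuousOn_iff_continuous_domRestrict.1 e.symm.continuousOn).measurable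
  have h2 := MeasurableSet.subtype_image e.open_target.measurableSet (h1 hA)
  convert h2 using 1
  ext z
  simp [Set.domRestrict, and_comm]

variable [IsManifold 𝓘(ℂ, ℂ) ω X]

theorem mdifferentiableAt_chart {p x : X} (hx : x ∈ (chartAt ℂ p).source) :
    MDifferentiableAt 𝓘(ℝ, ℂ) 𝓘(ℝ, ℂ) (chartAt ℂ p) x :=
  ((contMDiffOn_chart (I := 𝓘(ℝ, ℂ)) (n := ∞)).contMDiffAt
    ((chartAt ℂ p).open_source.mem_nhds hx)).mdifferentiableAt (by simp)

theorem mdifferentiableAt_chart_symm {p : X} {z : ℂ} (hz : z ∈ (chartAt ℂ p).target) :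
    MDifferentiableAt 𝓘(ℝ, ℂ) 𝓘(ℝ, ℂ) (chartAt ℂ p).symm z :=
  ((contMDiffOn_chart_symm (I := 𝓘(ℝ, ℂ)) (n := ∞)).contMDiffAt
    ((chartAt ℂ p).open_target.mem_nhds hz)).mdifferentiableAt (by simp)

theorem differentiableAt_coord {F : X → X} (hF : MDifferentiable 𝓘(ℝ, ℂ) 𝓘(ℝ, ℂ) F) {p q : X}
    {z : ℂ} (hz : z ∈ (chartAt ℂ p).target)
    (hq : F ((chartAt ℂ p).symm z) ∈ (chartAt ℂ q).source) :
    DifferentiableAt ℝ (fun z => chartAt ℂ q (F ((chartAt ℂ p).symm z))) z :=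
  mdifferentiableAt_iff_differentiableAt.1
    ((mdifferentiableAt_chart hq).comp z ((hF _).comp z (mdifferentiableAt_chart_symm hz)))

variable [RiemannianBundle (fun x : X => TangentSpace 𝓘(ℝ, ℂ) x)]

/-- By the chain rule the coordinate frame at `q`, applied to `dτ`, is the `F`-image of the frame at
`p`; the Gram determinants then differ by `(det dτ)²`. The case `F = id` is the change of charts,
the case `F = R` the invariance under reflection. -/
theorem chartDensity_comp {F : X → X} (hF : MDifferentiable 𝓘(ℝ, ℂ) 𝓘(ℝ, ℂ) F)
    (hiso : ∀ (x : X) (v w : TangentSpace 𝓘(ℝ, ℂ) x),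
      inner ℝ (mfderiv 𝓘(ℝ, ℂ) 𝓘(ℝ, ℂ) F x v) (mfderiv 𝓘(ℝ, ℂ) 𝓘(ℝ, ℂ) F x w) = inner ℝ v w)
    {p q : X} {z : ℂ} (hz : z ∈ (chartAt ℂ p).target)
    (hq : F ((chartAt ℂ p).symm z) ∈ (chartAt ℂ q).source) :
    chartDensity p z = |(fderiv ℝ (fun z => chartAt ℂ q (F ((chartAt ℂ p).symm z))) z).det|
      * chartDensity q (chartAt ℂ q (F ((chartAt ℂ p).symm z))) := by
  set τ : ℂ → ℂ := fun z => chartAt ℂ q (F ((chartAt ℂ p).symm z)) with hτ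
  have hd : DifferentiableAt ℝ τ z := differentiableAt_coord hF hz hq
  have hqt : τ z ∈ (chartAt ℂ q).target := (chartAt ℂ q).map_source hq
  have hy : (chartAt ℂ q).symm (τ z) = F ((chartAt ℂ p).symm z) := (chartAt ℂ q).left_inv hq
  have hev : (chartAt ℂ q).symm ∘ τ =ᶠ[𝓝 z] F ∘ (chartAt ℂ p).symm := by
    have hc : ContinuousAt (fun z => F ((chartAt ℂ p).symm z)) z :=
      ((hF _).comp z (mdifferentiableAt_chart_symm hz)).continuousAt
    filter_upwards [hc.preimage_mem_nhds ((chartAt ℂ q).open_source.mem_nhds hq)] with w hw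
    exact (chartAt ℂ q).left_inv hw
  have h1 := mfderiv_comp (I := 𝓘(ℝ, ℂ)) (I' := 𝓘(ℝ, ℂ)) (I'' := 𝓘(ℝ, ℂ)) z
    (mdifferentiableAt_chart_symm hqt) hd.mdifferentiableAt
  have h2 := mfderiv_comp (I := 𝓘(ℝ, ℂ)) (I' := 𝓘(ℝ, ℂ)) (I'' := 𝓘(ℝ, ℂ)) z
    (hF ((chartAt ℂ p).symm z)) (mdifferentiableAt_chart_symm hz)
  have h3 : ∀ v : ℂ, (coordVec q (τ z) (fderiv ℝ τ z v) : ℂ)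
      = mfderiv 𝓘(ℝ, ℂ) 𝓘(ℝ, ℂ) F ((chartAt ℂ p).symm z) (coordVec p z v) := by
    intro v
    have h4 := hev.mfderiv_eq (I := 𝓘(ℝ, ℂ)) (I' := 𝓘(ℝ, ℂ))
    have h5 := (h1.symm.trans h4).trans h2
    rw [mfderiv_eq_fderiv] at h5
    exact congrArg (fun L : ℂ →L[ℝ] ℂ => L v) h5
  -- The inner product depends on the base point. The points `y` and `y'` are only propositionally
  -- equal, so vectors are compared through their common model `ℂ`.
  have h6 : ∀ (y y' : X) (_ : y = y') (a b a' b' : ℂ), a = a' → b = b' →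
      inner ℝ (show TangentSpace 𝓘(ℝ, ℂ) y from a) (show TangentSpace 𝓘(ℝ, ℂ) y from b)
        = inner ℝ (show TangentSpace 𝓘(ℝ, ℂ) y' from a')
          (show TangentSpace 𝓘(ℝ, ℂ) y' from b') := by
    rintro y _ rfl a b _ _ rfl rfl
    rfl
  have h7 : ∀ v w : ℂ, inner ℝ (coordVec q (τ z) (fderiv ℝ τ z v))
      (coordVec q (τ z) (fderiv ℝ τ z w)) = inner ℝ (coordVec p z v) (coordVec p z w) := by
    intro v w
    rw [← hiso _ (coordVec p z v) (coordVec p z w)]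
    exact h6 _ _ hy _ _ _ _ (h3 v) (h3 w)
  have h8 := gram_comp (V := TangentSpace 𝓘(ℝ, ℂ) ((chartAt ℂ q).symm (τ z)))
    (mfderiv 𝓘(ℝ, ℂ) 𝓘(ℝ, ℂ) (chartAt ℂ q).symm (τ z)).toLinearMap (fderiv ℝ τ z)
  unfold chartDensity
  rw [← Real.sqrt_sq_eq_abs, ← Real.sqrt_mul (sq_nonneg _)]
  congr 1
  refine Eq.trans ?_ h8
  rw [← h7, ← h7, ← h7]
  rfl

variable [MeasurableSpace X] [BorelSpace X]

theorem chartVolume_apply (p : X) {A : Set X} (hA : MeasurableSet A) :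
    chartVolume p A = ∫⁻ z in (chartAt ℂ p).target ∩ (chartAt ℂ p).symm ⁻¹' A,
      ENNReal.ofReal (chartDensity p z) := by
  have hm : AEMeasurable (chartAt ℂ p).symm ((volume.restrict (chartAt ℂ p).target).withDensity
      (fun z => ENNReal.ofReal (chartDensity p z))) :=
    ((chartAt ℂ p).symm.continuousOn.aemeasurable
      (chartAt ℂ p).open_target.measurableSet).mono_ac (withDensity_absolutelyContinuous _ _)
  rw [chartVolume, Measure.map_apply_of_aemeasurable hm hA, withDensity_apply',
    Measure.restrict_restrict' (chartAt ℂ p).open_target.measurableSet, Set.inter_comm]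

theorem chartVolume_eq_inter_source (p : X) {A : Set X} (hA : MeasurableSet A) :
    chartVolume p A = chartVolume p (A ∩ (chartAt ℂ p).source) := by
  rw [chartVolume_apply p hA,
    chartVolume_apply p (hA.inter (chartAt ℂ p).open_source.measurableSet)]
  congr 2
  ext z
  simp only [Set.mem_inter_iff, Set.mem_preimage]
  exact ⟨fun h => ⟨h.1, h.2, (chartAt ℂ p).map_target h.1⟩, fun h => ⟨h.1, h.2.1⟩⟩

theorem chartVolume_preimage {F : X → X} (hF : MDifferentiable 𝓘(ℝ, ℂ) 𝓘(ℝ, ℂ) F)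
    (hiso : ∀ (x : X) (v w : TangentSpace 𝓘(ℝ, ℂ) x),
      inner ℝ (mfderiv 𝓘(ℝ, ℂ) 𝓘(ℝ, ℂ) F x v) (mfderiv 𝓘(ℝ, ℂ) 𝓘(ℝ, ℂ) F x w) = inner ℝ v w)
    (hinv : Function.Involutive F) {p q : X} {A : Set X} (hA : MeasurableSet A)
    (hp : A ⊆ (chartAt ℂ p).source) (hq : ∀ x ∈ A, F x ∈ (chartAt ℂ q).source) :
    chartVolume q (F ⁻¹' A) = chartVolume p A := by
  have hFA : MeasurableSet (F ⁻¹' A) := hF.continuous.measurable hA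
  set τ : ℂ → ℂ := fun z => chartAt ℂ q (F ((chartAt ℂ p).symm z)) with hτ
  set S := (chartAt ℂ p).target ∩ (chartAt ℂ p).symm ⁻¹' A with hS
  have himage : (chartAt ℂ q).target ∩ (chartAt ℂ q).symm ⁻¹' (F ⁻¹' A) = τ '' S := by
    ext w
    constructor
    · rintro ⟨hw, hwA⟩
      refine ⟨chartAt ℂ p (F ((chartAt ℂ q).symm w)),
        ⟨(chartAt ℂ p).map_source (hp hwA), ?_⟩, ?_⟩
      · rw [Set.mem_preimage, (chartAt ℂ p).left_inv (hp hwA)]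
        exact hwA
      · simp only [hτ]
        rw [(chartAt ℂ p).left_inv (hp hwA), hinv, (chartAt ℂ q).right_inv hw]
    · rintro ⟨z, ⟨hz, hzA⟩, rfl⟩
      refine ⟨(chartAt ℂ q).map_source (hq _ hzA), ?_⟩
      rw [Set.mem_preimage, Set.mem_preimage, (chartAt ℂ q).left_inv (hq _ hzA), hinv]
      exact hzA
  have hinj : Set.InjOn τ S := by
    rintro z ⟨hz, hzA⟩ w ⟨hw, hwA⟩ hzw
    exact (chartAt ℂ p).symm.injOn hz hw (hinv.injective
      ((chartAt ℂ q).injOn (hq _ hzA) (hq _ hwA) hzw))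
  rw [chartVolume_apply q hFA, chartVolume_apply p hA, himage,
    lintegral_image_eq_lintegral_abs_det_fderiv_mul volume
      (measurableSet_target_inter_preimage _ hA) (f' := fderiv ℝ τ)
      (fun z hz => (differentiableAt_coord hF hz.1 (hq _ hz.2)).hasFDerivAt.hasFDerivWithinAt) hinj]
  refine setLIntegral_congr_fun (measurableSet_target_inter_preimage _ hA) fun z hz => ?_
  rw [chartDensity_comp hF hiso hz.1 (hq _ hz.2), ENNReal.ofReal_mul (abs_nonneg _)]

/-- A supremum of measures is not computed set by set, so it is bounded by one explicit measure: the
chart measure plus infinite mass at each point outside the chart. Sets leaving the chart are then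
trivially dominated, and sets inside it are handled by the change of charts. -/
theorem riemannianVolume_apply_of_subset_source {p : X} {A : Set X} (hA : MeasurableSet A)
    (hp : A ⊆ (chartAt ℂ p).source) : riemannianVolume X A = chartVolume p A := by
  refine le_antisymm ?_ (Measure.le_iff'.1 (le_iSup (fun p : X => chartVolume p) p) A)
  set U := (chartAt ℂ p).source with hU
  have hUm : MeasurableSet U := (chartAt ℂ p).open_source.measurableSet
  have hle : riemannianVolume X
      ≤ chartVolume p + (⊤ : ENNReal) • (Measure.count.restrict Uᶜ) := by
    refine iSup_le fun q => Measure.le_iff.2 fun B hB => ?_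
    rcases (B \ U).eq_empty_or_nonempty with hBU | hBU
    · rw [Set.sdiff_eq_empty] at hBU
      have hBm : MeasurableSet (B ∩ (chartAt ℂ q).source) :=
        hB.inter (chartAt ℂ q).open_source.measurableSet
      rw [chartVolume_eq_inter_source q hB, Measure.add_apply]
      refine le_trans ?_ le_self_add
      have := chartVolume_preimage (F := id) mdifferentiable_id (fun x v w => by simp)
        (fun x => rfl) (p := p) (q := q) hBm (Set.inter_subset_left.trans hBU)
        (fun x hx => hx.2)
      rw [Set.preimage_id] at this
      rw [this]
      exact measure_mono Set.inter_subset_left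
    · have : Measure.count.restrict Uᶜ B ≠ 0 := by
        rw [Measure.restrict_apply hB, ← Set.sdiff_eq]
        exact Measure.count_ne_zero hBU
      simp [Measure.add_apply, ENNReal.top_mul this]
  have h0 : Measure.count.restrict Uᶜ A = 0 := by
    rw [Measure.restrict_apply hA, ← Set.sdiff_eq, Set.sdiff_eq_empty.2 hp]
    simp
  calc riemannianVolume X A ≤ _ := Measure.le_iff'.1 hle A
    _ = chartVolume p A := by simp [h0]

variable [CompactSpace X]

theorem exists_countable_chart_cover (X : Type*) [TopologicalSpace X] [ChartedSpace ℂ X]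
    [CompactSpace X] : ∃ s : Set X, s.Countable ∧ ⋃ p ∈ s, (chartAt ℂ p).source = Set.univ :=
  countable_cover_nhds_of_sigmaCompact fun x => chart_source_mem_nhds ℂ x

/-- Countably many pieces, each inside one chart and mapped into one chart, cover the surface; on
each piece the change of variables applies. -/
theorem map_riemannianVolume {F : X → X} (hF : MDifferentiable 𝓘(ℝ, ℂ) 𝓘(ℝ, ℂ) F)
    (hiso : ∀ (x : X) (v w : TangentSpace 𝓘(ℝ, ℂ) x),
      inner ℝ (mfderiv 𝓘(ℝ, ℂ) 𝓘(ℝ, ℂ) F x v) (mfderiv 𝓘(ℝ, ℂ) 𝓘(ℝ, ℂ) F x w) = inner ℝ v w)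
    (hinv : Function.Involutive F) :
    MeasurePreserving F (riemannianVolume X) (riemannianVolume X) := by
  have hFm := hF.continuous.measurable
  refine ⟨hFm, ?_⟩
  obtain ⟨s, hs, hcov⟩ := exists_countable_chart_cover X
  have := hs.to_subtype
  have hcov' (x : X) : ∃ p : s, x ∈ (chartAt ℂ (p : X)).source := by
    have : x ∈ ⋃ p ∈ s, (chartAt ℂ p).source := hcov ▸ Set.mem_univ x
    simpa using this
  have hU (p : X) : MeasurableSet (chartAt ℂ p).source := (chartAt ℂ p).open_source.measurableSet
  refine Measure.ext_of_iUnion_eq_univ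
    (s := fun i : s × s => (chartAt ℂ (i.1 : X)).source ∩ F ⁻¹' (chartAt ℂ (i.2 : X)).source)
    ?_ ?_
  · refine Set.eq_univ_of_forall fun x => ?_
    obtain ⟨p, hp⟩ := hcov' x
    obtain ⟨q, hq⟩ := hcov' (F x)
    exact Set.mem_iUnion.2 ⟨(p, q), hp, hq⟩
  · rintro ⟨p, q⟩
    refine Measure.ext fun A hA => ?_
    have hm := hA.inter ((hU p).inter (hFm (hU q)))
    rw [Measure.restrict_apply hA, Measure.restrict_apply hA, Measure.map_apply hFm hm,
      riemannianVolume_apply_of_subset_source hm (Set.inter_subset_right.trans Set.inter_subset_left),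
      riemannianVolume_apply_of_subset_source (p := (q : X)) (hFm hm)]
    · exact chartVolume_preimage hF hiso hinv hm
        (Set.inter_subset_right.trans Set.inter_subset_left) fun x hx => hx.2.2
    · intro x hx
      have := hx.2.2
      rwa [Set.mem_preimage, hinv] at this

theorem riemannianVolume_null {A : Set X} (hA : MeasurableSet A)
    (h : ∀ p : X, volume ((chartAt ℂ p).target ∩ (chartAt ℂ p).symm ⁻¹' A) = 0) :
    riemannianVolume X A = 0 := by
  obtain ⟨s, hs, hcov⟩ := exists_countable_chart_cover X
  have hA' : A = ⋃ p ∈ s, A ∩ (chartAt ℂ p).source := by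
    rw [← Set.inter_iUnion₂, hcov, Set.inter_univ]
  rw [hA', measure_biUnion_null_iff hs]
  intro p _
  rw [riemannianVolume_apply_of_subset_source
    (hA.inter (chartAt ℂ p).open_source.measurableSet) Set.inter_subset_right,
    ← chartVolume_eq_inter_source p hA, chartVolume_apply p hA]
  exact setLIntegral_measure_zero _ _ (h p)

end Volume

theorem finrank_tangentSpace {X : Type*} [TopologicalSpace X] [ChartedSpace ℂ X] (x : X) :
    Module.finrank ℝ (TangentSpace 𝓘(ℝ, ℂ) x) = 2 :=
  Complex.finrank_real_complex

/-! ### Continuity of the metric in charts and of `|dφ|²`; finiteness of the volume. -/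

section Continuity

variable {X : Type*} [TopologicalSpace X] [ChartedSpace ℂ X] [IsManifold 𝓘(ℂ, ℂ) ω X]

theorem continuousOn_coordVec (p : X) (v : ℂ) :
    ContinuousOn (fun z => (⟨(chartAt ℂ p).symm z, coordVec p z v⟩ :
      TotalSpace ℂ (fun x : X => TangentSpace 𝓘(ℝ, ℂ) x))) (chartAt ℂ p).target := by
  have h1 := (contMDiffOn_chart_symm (I := 𝓘(ℝ, ℂ)) (n := ∞) (x := p)).continuousOn_tangentMapWithin
    (by simp) (chartAt ℂ p).open_target.uniqueMDiffOn
  have h2 : Continuous (fun z : ℂ => (⟨z, v⟩ : TangentBundle 𝓘(ℝ, ℂ) ℂ)) :=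
    (tangentBundleModelSpaceHomeomorph 𝓘(ℝ, ℂ)).symm.continuous.comp
      (by fun_prop : Continuous fun z : ℂ => ((z, v) : ModelProd ℂ ℂ))
  refine (h1.comp h2.continuousOn fun z hz => hz).congr fun z hz => ?_
  simp only [Function.comp_apply, tangentMapWithin, coordVec]
  rw [mfderivWithin_of_isOpen (chartAt ℂ p).open_target hz]

variable [RiemannianBundle (fun x : X => TangentSpace 𝓘(ℝ, ℂ) x)]
  [IsContMDiffRiemannianBundle 𝓘(ℝ, ℂ) ∞ ℂ (fun x : X => TangentSpace 𝓘(ℝ, ℂ) x)]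

theorem continuousOn_inner_coordVec (p : X) (v w : ℂ) :
    ContinuousOn (fun z => (inner ℝ (coordVec p z v) (coordVec p z w) : ℝ))
      (chartAt ℂ p).target := by
  obtain ⟨g, hg, hgi⟩ := IsContMDiffRiemannianBundle.exists_contMDiff (IB := 𝓘(ℝ, ℂ)) (n := ∞)
    (F := ℂ) (E := fun x : X => TangentSpace 𝓘(ℝ, ℂ) x)
  have : IsContinuousRiemannianBundle ℂ (fun x : X => TangentSpace 𝓘(ℝ, ℂ) x) :=
    ⟨g, hg.continuous, hgi⟩
  exact ContinuousOn.inner_bundle (F := ℂ) (continuousOn_coordVec p v) (continuousOn_coordVec p w)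

theorem continuousOn_chartDensity (p : X) :
    ContinuousOn (chartDensity p) (chartAt ℂ p).target :=
  (((continuousOn_inner_coordVec p _ _).mul (continuousOn_inner_coordVec p _ _)).sub
    ((continuousOn_inner_coordVec p _ _).pow 2)).sqrt

theorem isFiniteMeasure_riemannianVolume [CompactSpace X] [MeasurableSpace X] [BorelSpace X] :
    IsFiniteMeasure (riemannianVolume X) := by
  refine ⟨isCompact_univ.measure_lt_top_of_nhdsWithin fun x _ => ?_⟩
  obtain ⟨r, hr, hball⟩ := Metric.nhds_basis_closedBall.mem_iff.1
    ((chartAt ℂ x).open_target.mem_nhds (mem_chart_target ℂ x))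
  set U := (chartAt ℂ x).source ∩ chartAt ℂ x ⁻¹' Metric.ball (chartAt ℂ x x) r with hU
  have hUo : IsOpen U := (chartAt ℂ x).isOpen_inter_preimage Metric.isOpen_ball
  refine ⟨U, mem_nhdsWithin_of_mem_nhds (hUo.mem_nhds ⟨mem_chart_source ℂ x, by simpa⟩), ?_⟩
  rw [riemannianVolume_apply_of_subset_source hUo.measurableSet Set.inter_subset_left,
    chartVolume_apply x hUo.measurableSet]
  have hi : IntegrableOn (chartDensity x) (Metric.closedBall (chartAt ℂ x x) r) :=
    ((continuousOn_chartDensity x).mono hball).integrableOn_compact (isCompact_closedBall _ _)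
  refine lt_of_le_of_lt (lintegral_mono_set ?_) hi.lintegral_lt_top
  rintro z ⟨hz, hzU⟩
  have := hzU.2
  rw [Set.mem_preimage, (chartAt ℂ x).right_inv hz] at this
  exact Metric.ball_subset_closedBall this

/-- The chart composed with its inverse is the identity near `z`, so the differential of the inverse
chart is injective and the coordinate frame is independent. -/
theorem gram_coordVec_pos (p : X) {z : ℂ} (hz : z ∈ (chartAt ℂ p).target) :
    0 < (inner ℝ (coordVec p z 1) (coordVec p z 1) : ℝ)
      * inner ℝ (coordVec p z Complex.I) (coordVec p z Complex.I)
      - inner ℝ (coordVec p z 1) (coordVec p z Complex.I) ^ 2 := by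
  refine gram_pos fun s t hst => ?_
  have h1 : mfderiv 𝓘(ℝ, ℂ) 𝓘(ℝ, ℂ) (chartAt ℂ p).symm z (s + t * Complex.I : ℂ) = 0 := by
    rw [← hst]
    have : (s + t * Complex.I : ℂ) = s • (1 : ℂ) + t • Complex.I := by simp
    rw [this]
    simp only [coordVec]
    exact ((mfderiv 𝓘(ℝ, ℂ) 𝓘(ℝ, ℂ) (chartAt ℂ p).symm z).map_add _ _).trans
      (congrArg₂ _ (map_smul _ _ _) (map_smul _ _ _))
  have h2 := mfderiv_comp (I := 𝓘(ℝ, ℂ)) (I' := 𝓘(ℝ, ℂ)) (I'' := 𝓘(ℝ, ℂ)) z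
    (mdifferentiableAt_chart ((chartAt ℂ p).map_target hz)) (mdifferentiableAt_chart_symm hz)
  have h3 : chartAt ℂ p ∘ (chartAt ℂ p).symm =ᶠ[𝓝 z] id := by
    filter_upwards [(chartAt ℂ p).open_target.mem_nhds hz] with w hw
    exact (chartAt ℂ p).right_inv hw
  have h4 := (h3.mfderiv_eq (I := 𝓘(ℝ, ℂ)) (I' := 𝓘(ℝ, ℂ))).symm.trans h2
  rw [mfderiv_id] at h4
  have h5 : (s + t * Complex.I : ℂ) = 0 := by
    have := congrArg (fun L : ℂ →L[ℝ] ℂ => L (s + t * Complex.I)) h4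
    refine this.trans ?_
    exact (congrArg (mfderiv 𝓘(ℝ, ℂ) 𝓘(ℝ, ℂ) (chartAt ℂ p) ((chartAt ℂ p).symm z)) h1).trans
      (ContinuousLinearMap.map_zero _)
  constructor
  · simpa using congrArg Complex.re h5
  · simpa using congrArg Complex.im h5

variable {𝕜 : Type*} [RCLike 𝕜]

theorem differential_coordVec {φ : X → 𝕜} (hφ : MDifferentiable 𝓘(ℝ, ℂ) 𝓘(ℝ, 𝕜) φ) (p : X)
    {z : ℂ} (hz : z ∈ (chartAt ℂ p).target) (v : ℂ) :
    differential φ ((chartAt ℂ p).symm z) (coordVec p z v)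
      = fderiv ℝ (φ ∘ (chartAt ℂ p).symm) z v := by
  have h1 := mfderiv_comp (I := 𝓘(ℝ, ℂ)) (I' := 𝓘(ℝ, ℂ)) (I'' := 𝓘(ℝ, 𝕜)) z
    (hφ _) (mdifferentiableAt_chart_symm hz)
  rw [mfderiv_eq_fderiv] at h1
  exact (congrArg (fun L : ℂ →L[ℝ] 𝕜 => L v) h1).symm

theorem normSqDifferential_mul_gram {φ : X → 𝕜} (hφ : MDifferentiable 𝓘(ℝ, ℂ) 𝓘(ℝ, 𝕜) φ) (p : X)
    {z : ℂ} (hz : z ∈ (chartAt ℂ p).target) :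
    normSqDifferential φ ((chartAt ℂ p).symm z)
      * ((inner ℝ (coordVec p z 1) (coordVec p z 1) : ℝ)
        * inner ℝ (coordVec p z Complex.I) (coordVec p z Complex.I)
        - inner ℝ (coordVec p z 1) (coordVec p z Complex.I) ^ 2)
      = inner ℝ (coordVec p z Complex.I) (coordVec p z Complex.I)
          * ‖fderiv ℝ (φ ∘ (chartAt ℂ p).symm) z 1‖ ^ 2
        + inner ℝ (coordVec p z 1) (coordVec p z 1)
          * ‖fderiv ℝ (φ ∘ (chartAt ℂ p).symm) z Complex.I‖ ^ 2
        - 2 * inner ℝ (coordVec p z 1) (coordVec p z Complex.I)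
          * (RCLike.re (fderiv ℝ (φ ∘ (chartAt ℂ p).symm) z 1)
              * RCLike.re (fderiv ℝ (φ ∘ (chartAt ℂ p).symm) z Complex.I)
            + RCLike.im (fderiv ℝ (φ ∘ (chartAt ℂ p).symm) z 1)
              * RCLike.im (fderiv ℝ (φ ∘ (chartAt ℂ p).symm) z Complex.I)) := by
  rw [← differential_coordVec hφ p hz, ← differential_coordVec hφ p hz]
  exact sum_norm_sq_mul_gram (𝕜 := 𝕜) (finrank_tangentSpace ((chartAt ℂ p).symm z))
    (mfderiv 𝓘(ℝ, ℂ) 𝓘(ℝ, 𝕜) φ ((chartAt ℂ p).symm z)).toLinearMap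
    (coordVec p z 1) (coordVec p z Complex.I)

theorem contDiffOn_comp_chart_symm {φ : X → 𝕜} (hφ : ContMDiff 𝓘(ℝ, ℂ) 𝓘(ℝ, 𝕜) ∞ φ) (p : X) :
    ContDiffOn ℝ ∞ (φ ∘ (chartAt ℂ p).symm) (chartAt ℂ p).target :=
  contMDiffOn_iff_contDiffOn.1 (hφ.comp_contMDiffOn contMDiffOn_chart_symm)

/-- The orthonormal bases are chosen pointwise, with no continuity. In a chart the Gram formula
writes `|dφ|²` as a quotient of continuous functions with positive denominator. -/
theorem continuous_normSqDifferential {φ : X → 𝕜} (hφ : ContMDiff 𝓘(ℝ, ℂ) 𝓘(ℝ, 𝕜) ∞ φ) :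
    Continuous (normSqDifferential φ) := by
  have hd : MDifferentiable 𝓘(ℝ, ℂ) 𝓘(ℝ, 𝕜) φ := hφ.mdifferentiable (by simp)
  refine continuous_iff_continuousAt.2 fun p => ?_
  set f := φ ∘ (chartAt ℂ p).symm
  have hf : ContinuousOn (fderiv ℝ f) (chartAt ℂ p).target :=
    (contDiffOn_comp_chart_symm hφ p).continuousOn_fderiv_of_isOpen (chartAt ℂ p).open_target
      (by simp)
  have hl (v : ℂ) : ContinuousOn (fun z => fderiv ℝ f z v) (chartAt ℂ p).target :=
    hf.clm_apply continuousOn_const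
  have hG := continuousOn_inner_coordVec p
  have key : ContinuousOn (fun z => normSqDifferential φ ((chartAt ℂ p).symm z))
      (chartAt ℂ p).target := by
    have h1 := ((((hG Complex.I Complex.I).mul ((hl 1).norm.pow 2)).add
      ((hG 1 1).mul ((hl Complex.I).norm.pow 2))).sub
      (((hG 1 Complex.I).const_mul 2).mul
        (((RCLike.continuous_re.comp_continuousOn (hl 1)).mul
          (RCLike.continuous_re.comp_continuousOn (hl Complex.I))).add
        ((RCLike.continuous_im.comp_continuousOn (hl 1)).mul
          (RCLike.continuous_im.comp_continuousOn (hl Complex.I)))))).div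
      (((hG 1 1).mul (hG Complex.I Complex.I)).sub ((hG 1 Complex.I).pow 2))
      fun z hz => (gram_coordVec_pos p hz).ne'
    refine h1.congr fun z hz => ?_
    exact (eq_div_iff (gram_coordVec_pos p hz).ne').2 (normSqDifferential_mul_gram hd p hz)
  have h2 := (key.comp (chartAt ℂ p).continuousOn fun x hx => (chartAt ℂ p).map_source hx).continuousAt
    ((chartAt ℂ p).open_source.mem_nhds (mem_chart_source ℂ p))
  refine h2.congr ?_
  filter_upwards [(chartAt ℂ p).open_source.mem_nhds (mem_chart_source ℂ p)] with x hx
  simp [(chartAt ℂ p).left_inv hx]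

end Continuity

/-! ### Pointwise rules for `|dφ|²`. -/

section Differential

variable {X : Type*} [TopologicalSpace X] [ChartedSpace ℂ X]
  [RiemannianBundle (fun x : X => TangentSpace 𝓘(ℝ, ℂ) x)] {𝕜 : Type*} [RCLike 𝕜]

theorem normSqDifferential_nonneg (φ : X → 𝕜) (x : X) : 0 ≤ normSqDifferential φ x :=
  Finset.sum_nonneg fun _ _ => sq_nonneg _

theorem normSqDifferential_comp {F : X → X} (hF : MDifferentiable 𝓘(ℝ, ℂ) 𝓘(ℝ, ℂ) F)
    (hiso : ∀ (x : X) (v w : TangentSpace 𝓘(ℝ, ℂ) x),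
      inner ℝ (mfderiv 𝓘(ℝ, ℂ) 𝓘(ℝ, ℂ) F x v) (mfderiv 𝓘(ℝ, ℂ) 𝓘(ℝ, ℂ) F x w) = inner ℝ v w)
    {φ : X → 𝕜} (hφ : MDifferentiable 𝓘(ℝ, ℂ) 𝓘(ℝ, 𝕜) φ) (x : X) :
    normSqDifferential (φ ∘ F) x = normSqDifferential φ (F x) := by
  have h := sum_norm_sq_comp_isometry (𝕜 := 𝕜) (finrank_tangentSpace x) (finrank_tangentSpace (F x))
    (mfderiv 𝓘(ℝ, ℂ) 𝓘(ℝ, 𝕜) φ (F x)).toLinearMap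
    (mfderiv 𝓘(ℝ, ℂ) 𝓘(ℝ, ℂ) F x).toLinearMap (hiso x)
  refine Eq.trans ?_ h
  unfold normSqDifferential differential
  rw [mfderiv_comp x (hφ _) (hF x)]
  rfl

theorem normSqDifferential_congr {φ ψ : X → 𝕜} {x : X} (h : φ =ᶠ[𝓝 x] ψ) :
    normSqDifferential φ x = normSqDifferential ψ x := by
  unfold normSqDifferential differential
  rw [h.mfderiv_eq]
  rfl

theorem normSqDifferential_zero (x : X) : normSqDifferential (0 : X → 𝕜) x = 0 := by
  have h : mfderiv 𝓘(ℝ, ℂ) 𝓘(ℝ, 𝕜) (0 : X → 𝕜) x = 0 := mfderiv_const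
  unfold normSqDifferential differential
  rw [h]
  exact Finset.sum_eq_zero fun i _ => by
    change ‖(0 : 𝕜)‖ ^ 2 = 0
    simp

theorem normSqDifferential_smul (c : ℝ) {φ : X → 𝕜} {x : X}
    (hφ : MDifferentiableAt 𝓘(ℝ, ℂ) 𝓘(ℝ, 𝕜) φ x) :
    normSqDifferential (c • φ) x = c ^ 2 * normSqDifferential φ x := by
  unfold normSqDifferential differential
  rw [const_smul_mfderiv hφ c, Finset.mul_sum]
  refine Finset.sum_congr rfl fun i _ => ?_
  have : ∀ a : 𝕜, ‖c • a‖ ^ 2 = c ^ 2 * ‖a‖ ^ 2 := fun a => by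
    rw [norm_smul, mul_pow, Real.norm_eq_abs, sq_abs]
  exact this _

/-- The free weight `δ` lets the triangle inequality for the `H¹` norm be recovered after
integration, in `smoothH1Norm_add_le`. -/
theorem norm_add_sq_le_weighted {E : Type*} [SeminormedAddCommGroup E] (a b : E) {δ : ℝ} (hδ : 0 < δ) :
    ‖a + b‖ ^ 2 ≤ (1 + δ) * ‖a‖ ^ 2 + (1 + δ⁻¹) * ‖b‖ ^ 2 := by
  have h1 := norm_add_le a b
  have h2 : 2 * ‖a‖ * ‖b‖ ≤ δ * ‖a‖ ^ 2 + δ⁻¹ * ‖b‖ ^ 2 := by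
    have h3 : 0 ≤ δ⁻¹ * (δ * ‖a‖ - ‖b‖) ^ 2 := by positivity
    have h4 : δ⁻¹ * (δ * ‖a‖ - ‖b‖) ^ 2 = δ * ‖a‖ ^ 2 + δ⁻¹ * ‖b‖ ^ 2 - 2 * ‖a‖ * ‖b‖ := by
      field_simp
      ring
    linarith
  nlinarith [norm_nonneg (a + b), norm_nonneg a, norm_nonneg b]

theorem normSqDifferential_add_le {φ ψ : X → 𝕜} {x : X}
    (hφ : MDifferentiableAt 𝓘(ℝ, ℂ) 𝓘(ℝ, 𝕜) φ x) (hψ : MDifferentiableAt 𝓘(ℝ, ℂ) 𝓘(ℝ, 𝕜) ψ x)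
    {δ : ℝ} (hδ : 0 < δ) :
    normSqDifferential (φ + ψ) x
      ≤ (1 + δ) * normSqDifferential φ x + (1 + δ⁻¹) * normSqDifferential ψ x := by
  unfold normSqDifferential differential
  rw [mfderiv_add hφ hψ, Finset.mul_sum, Finset.mul_sum, ← Finset.sum_add_distrib]
  exact Finset.sum_le_sum fun i _ => norm_add_sq_le_weighted (E := 𝕜) _ _ hδ

theorem normSqDifferential_comp_le {φ : X → 𝕜} {x : X}
    (hφ : MDifferentiableAt 𝓘(ℝ, ℂ) 𝓘(ℝ, 𝕜) φ x) {G : 𝕜 → 𝕜} (hG : DifferentiableAt ℝ G (φ x))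
    {C : ℝ} (hC : ‖fderiv ℝ G (φ x)‖ ≤ C) :
    normSqDifferential (G ∘ φ) x ≤ C ^ 2 * normSqDifferential φ x := by
  unfold normSqDifferential differential
  rw [mfderiv_comp x hG.mdifferentiableAt hφ, mfderiv_eq_fderiv, Finset.mul_sum]
  refine Finset.sum_le_sum fun i _ => ?_
  have : ∀ a : 𝕜, ‖fderiv ℝ G (φ x) a‖ ^ 2 ≤ C ^ 2 * ‖a‖ ^ 2 := fun a => by
    rw [← mul_pow]
    gcongr
    exact (fderiv ℝ G (φ x)).le_of_opNorm_le hC a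
  exact this _

end Differential

/-! ### Null sets: the boundary, and the points of a zero set with nonzero differential. -/

section NullSets

theorem volume_im_eq_zero : volume {z : ℂ | z.im = 0} = 0 := by
  have h := Measure.addHaar_submodule (volume : Measure ℂ) (LinearMap.ker Complex.imLm)
    (fun h => by simpa using (h ▸ Submodule.mem_top : Complex.I ∈ LinearMap.ker Complex.imLm))
  exact h

/-- The derivative of a function vanishes almost everywhere on its zero set. -/
theorem volume_fderiv_ne_zero {𝕜 : Type*} [RCLike 𝕜] {f : ℂ → 𝕜} {T : Set ℂ}
    (hT : MeasurableSet T) (hf : ∀ z ∈ T, DifferentiableAt ℝ f z) (h0 : ∀ z ∈ T, f z = 0) :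
    ∀ᵐ z ∂volume.restrict T, fderiv ℝ f z = 0 := by
  have key (L : 𝕜 →L[ℝ] ℝ) : ∀ᵐ z ∂volume.restrict T, L.comp (fderiv ℝ f z) = 0 := by
    set A : 𝕜 →L[ℝ] ℂ := Complex.ofRealCLM.comp L
    -- On `T` the function is constant, hence approximated by the zero map with error constant `0`;
    -- this forces the derivative to vanish at almost every point of `T`. The functional `L` is
    -- followed by `ℝ → ℂ` to obtain a map of `ℂ` to itself.
    have h1 : ApproximatesLinearOn (A ∘ f) (0 : ℂ →L[ℝ] ℂ) T 0 := fun z hz w hw => by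
      simp [h0 z hz, h0 w hw]
    have h2 := h1.norm_fderiv_sub_le volume hT (fun z => A.comp (fderiv ℝ f z))
      fun z hz => (A.hasFDerivAt.comp z (hf z hz).hasFDerivAt).hasFDerivWithinAt
    filter_upwards [h2] with z hz
    have h3 : A.comp (fderiv ℝ f z) = 0 := by simpa using hz
    ext v
    have := congrArg (fun B : ℂ →L[ℝ] ℂ => (B v).re) h3
    simpa [A] using this
  filter_upwards [key RCLike.reCLM, key RCLike.imCLM] with z hre him
  ext v
  refine RCLike.ext ?_ ?_
  · simpa using congrArg (fun B : ℂ →L[ℝ] ℝ => B v) hre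
  · simpa using congrArg (fun B : ℂ →L[ℝ] ℝ => B v) him

variable {X : Type*} [TopologicalSpace X] [ChartedSpace ℂ X] [IsManifold 𝓘(ℂ, ℂ) ω X]
  [RiemannianBundle (fun x : X => TangentSpace 𝓘(ℝ, ℂ) x)]
  [MeasurableSpace X] [BorelSpace X] [CompactSpace X]

/-- Boundary points are fixed by `R`, so they have real coordinate in a boundary chart. In any other
chart they lie in the differentiable image of a subset of the real line. -/
theorem riemannianVolume_frontier {M : Set X} {R : X → X} (hdouble : IsDouble M R) :
    riemannianVolume X (frontier M) = 0 := by
  refine riemannianVolume_null isClosed_frontier.measurableSet fun p => ?_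
  refine measure_null_of_locally_null _ fun z hz => ?_
  obtain ⟨e, he, hpe, hmem⟩ := hdouble.boundary_chart _ hz.2
  set V := (chartAt ℂ p).target ∩ (chartAt ℂ p).symm ⁻¹' e.source
  have hV : IsOpen V := (chartAt ℂ p).isOpen_inter_preimage_symm e.open_source
  set σ : ℂ → ℂ := chartAt ℂ p ∘ e.symm
  set L : Set ℂ := {w | w ∈ e.target ∧ e.symm w ∈ (chartAt ℂ p).source ∧ w.im = 0}
  refine ⟨_, inter_mem_nhdsWithin _ (hV.mem_nhds ⟨hz.1, hpe⟩), ?_⟩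
  have hsub : (chartAt ℂ p).target ∩ (chartAt ℂ p).symm ⁻¹' frontier M ∩ V ⊆ σ '' L := by
    rintro w ⟨⟨hw, hwM⟩, -, hwe⟩
    have hconj := (hmem _ hwe).2.2
    rw [hdouble.fixes_boundary _ hwM] at hconj
    refine ⟨e ((chartAt ℂ p).symm w), ⟨e.map_source hwe, ?_, ?_⟩, ?_⟩
    · rw [e.left_inv hwe]
      exact (chartAt ℂ p).map_target hw
    · exact Complex.conj_eq_iff_im.1 hconj.symm
    · simp only [σ, Function.comp_apply]
      rw [e.left_inv hwe, (chartAt ℂ p).right_inv hw]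
  refine measure_mono_null hsub ?_
  refine addHaar_image_eq_zero_of_differentiableOn_of_addHaar_eq_zero volume (fun w hw => ?_)
    (measure_mono_null (fun w hw => hw.2.2) volume_im_eq_zero)
  have h1 : MDifferentiableAt 𝓘(ℂ, ℂ) 𝓘(ℂ, ℂ) e.symm w :=
    ((contMDiffOn_symm_of_mem_maximalAtlas he).contMDiffAt
      (e.open_target.mem_nhds hw.1)).mdifferentiableAt (by simp)
  have h2 : MDifferentiableAt 𝓘(ℂ, ℂ) 𝓘(ℂ, ℂ) (chartAt ℂ p) (e.symm w) :=
    ((contMDiffOn_chart (I := 𝓘(ℂ, ℂ)) (n := ω)).contMDiffAt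
      ((chartAt ℂ p).open_source.mem_nhds hw.2.1)).mdifferentiableAt (by simp)
  have h3 : DifferentiableAt ℂ σ w := mdifferentiableAt_iff_differentiableAt.1 (h2.comp w h1)
  exact (h3.restrictScalars ℝ).differentiableWithinAt

variable [IsContMDiffRiemannianBundle 𝓘(ℝ, ℂ) ∞ ℂ (fun x : X => TangentSpace 𝓘(ℝ, ℂ) x)]

theorem ae_normSqDifferential_eq_zero {𝕜 : Type*} [RCLike 𝕜] {φ : X → 𝕜}
    (hφ : ContMDiff 𝓘(ℝ, ℂ) 𝓘(ℝ, 𝕜) ∞ φ) :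
    ∀ᵐ x ∂riemannianVolume X, φ x = 0 → normSqDifferential φ x = 0 := by
  have hd : MDifferentiable 𝓘(ℝ, ℂ) 𝓘(ℝ, 𝕜) φ := hφ.mdifferentiable (by simp)
  have hφ0 : MeasurableSet {x | φ x = 0} :=
    (isClosed_singleton.preimage hφ.continuous).measurableSet
  have hA : MeasurableSet {x | ¬(φ x = 0 → normSqDifferential φ x = 0)} := by
    have h2 : MeasurableSet {x | normSqDifferential φ x = 0} :=
      (isClosed_singleton.preimage (continuous_normSqDifferential hφ)).measurableSet
    convert hφ0.diff h2 using 1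
    ext x
    simp
  refine riemannianVolume_null hA fun p => ?_
  set T := (chartAt ℂ p).target ∩ (chartAt ℂ p).symm ⁻¹' {x | φ x = 0}
  have hT : MeasurableSet T := measurableSet_target_inter_preimage _ hφ0
  have h1 := volume_fderiv_ne_zero (f := φ ∘ (chartAt ℂ p).symm) hT
    (fun z hz => ((contDiffOn_comp_chart_symm hφ p).contDiffAt
      ((chartAt ℂ p).open_target.mem_nhds hz.1)).differentiableAt (by simp)) fun z hz => hz.2
  rw [ae_restrict_iff' hT] at h1
  refine measure_mono_null ?_ h1
  rintro z ⟨hz, hzA⟩ hT0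
  refine hzA fun h0 => ?_
  have h2 := normSqDifferential_mul_gram hd p hz
  rw [hT0 ⟨hz, h0⟩] at h2
  rw [zero_apply, zero_apply] at h2
  refine (mul_eq_zero.1 (h2.trans ?_)).resolve_right (gram_coordVec_pos p hz).ne'
  simp

end NullSets

/-! ### The energy density -/

section Energy

variable {X : Type*} [TopologicalSpace X] [ChartedSpace ℂ X]
  [RiemannianBundle (fun x : X => TangentSpace 𝓘(ℝ, ℂ) x)] {𝕜 : Type*} [RCLike 𝕜]

/-- The integrand `|φ|² + h² |dφ|²` of the semiclassical norm. -/
def energyDensity (h : ℝ) (φ : X → 𝕜) (x : X) : ℝ :=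
  ‖φ x‖ ^ 2 + h ^ 2 * normSqDifferential φ x

theorem energyDensity_nonneg (h : ℝ) (φ : X → 𝕜) (x : X) : 0 ≤ energyDensity h φ x :=
  add_nonneg (sq_nonneg _) (mul_nonneg (sq_nonneg _) (normSqDifferential_nonneg _ _))

theorem energyDensity_congr {h : ℝ} {φ ψ : X → 𝕜} {x : X} (he : φ =ᶠ[𝓝 x] ψ) :
    energyDensity h φ x = energyDensity h ψ x := by
  rw [energyDensity, energyDensity, he.eq_of_nhds, normSqDifferential_congr he]

theorem energyDensity_zero (h : ℝ) (x : X) : energyDensity h (0 : X → 𝕜) x = 0 := by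
  simp [energyDensity, normSqDifferential_zero]

theorem energyDensity_comp {F : X → X} (hF : MDifferentiable 𝓘(ℝ, ℂ) 𝓘(ℝ, ℂ) F)
    (hiso : ∀ (x : X) (v w : TangentSpace 𝓘(ℝ, ℂ) x),
      inner ℝ (mfderiv 𝓘(ℝ, ℂ) 𝓘(ℝ, ℂ) F x v) (mfderiv 𝓘(ℝ, ℂ) 𝓘(ℝ, ℂ) F x w) = inner ℝ v w)
    (h : ℝ) {φ : X → 𝕜} (hφ : MDifferentiable 𝓘(ℝ, ℂ) 𝓘(ℝ, 𝕜) φ) (x : X) :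
    energyDensity h (φ ∘ F) x = energyDensity h φ (F x) := by
  rw [energyDensity, energyDensity, normSqDifferential_comp hF hiso hφ, Function.comp_apply]

theorem energyDensity_smul (h c : ℝ) {φ : X → 𝕜} {x : X}
    (hφ : MDifferentiableAt 𝓘(ℝ, ℂ) 𝓘(ℝ, 𝕜) φ x) :
    energyDensity h (c • φ) x = c ^ 2 * energyDensity h φ x := by
  rw [energyDensity, energyDensity, normSqDifferential_smul c hφ, Pi.smul_apply, norm_smul,
    mul_pow, Real.norm_eq_abs, sq_abs]
  ring

theorem energyDensity_add_le (h : ℝ) {φ ψ : X → 𝕜} {x : X}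
    (hφ : MDifferentiableAt 𝓘(ℝ, ℂ) 𝓘(ℝ, 𝕜) φ x) (hψ : MDifferentiableAt 𝓘(ℝ, ℂ) 𝓘(ℝ, 𝕜) ψ x)
    {δ : ℝ} (hδ : 0 < δ) :
    energyDensity h (φ + ψ) x
      ≤ (1 + δ) * energyDensity h φ x + (1 + δ⁻¹) * energyDensity h ψ x := by
  have h1 := norm_add_sq_le_weighted (φ x) (ψ x) hδ
  have h2 := mul_le_mul_of_nonneg_left (normSqDifferential_add_le hφ hψ hδ) (sq_nonneg h)
  simp only [energyDensity, Pi.add_apply]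
  linarith

theorem energyDensity_comp_le (h : ℝ) {φ : X → 𝕜} {x : X}
    (hφ : MDifferentiableAt 𝓘(ℝ, ℂ) 𝓘(ℝ, 𝕜) φ x) {G : 𝕜 → 𝕜} (hG : DifferentiableAt ℝ G (φ x))
    {C : ℝ} (hGC : ‖G (φ x)‖ ≤ C * ‖φ x‖) (hC : ‖fderiv ℝ G (φ x)‖ ≤ C) :
    energyDensity h (G ∘ φ) x ≤ C ^ 2 * energyDensity h φ x := by
  have h1 : ‖G (φ x)‖ ^ 2 ≤ C ^ 2 * ‖φ x‖ ^ 2 := by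
    rw [← mul_pow]
    gcongr
  have h2 := mul_le_mul_of_nonneg_left (normSqDifferential_comp_le hφ hG hC) (sq_nonneg h)
  simp only [energyDensity, Function.comp_apply]
  linarith

theorem continuous_energyDensity [IsManifold 𝓘(ℂ, ℂ) ω X]
    [IsContMDiffRiemannianBundle 𝓘(ℝ, ℂ) ∞ ℂ (fun x : X => TangentSpace 𝓘(ℝ, ℂ) x)] (h : ℝ)
    {φ : X → 𝕜} (hφ : ContMDiff 𝓘(ℝ, ℂ) 𝓘(ℝ, 𝕜) ∞ φ) : Continuous (energyDensity h φ) :=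
  (hφ.continuous.norm.pow 2).add (continuous_const.mul (continuous_normSqDifferential hφ))

end Energy

/-! ### Approximation by test functions -/

/-- Then `t + H t` vanishes for `‖t‖ ≤ ε` and equals `t` for `‖t‖ ≥ 2ε`. The rescaling `ε B(t / ε)`
leaves the bound on the derivative unchanged, so `C` does not depend on `ε`. -/
theorem exists_cutoff (𝕜 : Type*) [RCLike 𝕜] : ∃ C : ℝ, ∀ ε > 0, ∃ H : 𝕜 → 𝕜,
    ContDiff ℝ ∞ H ∧ (∀ t, ‖t‖ ≤ ε → H t = -t) ∧ (∀ t, 2 * ε ≤ ‖t‖ → H t = 0) ∧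
    (∀ t, ‖H t‖ ≤ C * ‖t‖) ∧ ∀ t, ‖fderiv ℝ H t‖ ≤ C := by
  let b : ContDiffBump (0 : 𝕜) := ⟨1, 2, one_pos, one_lt_two⟩
  let B : 𝕜 → 𝕜 := fun t => -(b t • t)
  have hB : ContDiff ℝ ∞ B := (b.contDiff.smul contDiff_id).neg
  have hBs : HasCompactSupport B := by
    refine HasCompactSupport.intro b.hasCompactSupport fun t ht => ?_
    have : b t = 0 := image_eq_zero_of_notMem_tsupport ht
    simp [B, this]
  obtain ⟨C, hC⟩ := ((hB.continuous_fderiv (by simp)).norm).bddAbove_range_of_hasCompactSupport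
    (hBs.fderiv ℝ).norm
  have hC' (t : 𝕜) : ‖fderiv ℝ B t‖ ≤ C := hC ⟨t, rfl⟩
  -- `C` bounds the derivative; `1` bounds the bump function and hence `‖H t‖ / ‖t‖`.
  refine ⟨max C 1, fun ε hε => ⟨fun t => ε • B (ε⁻¹ • t), ?_, ?_, ?_, ?_, ?_⟩⟩
  · exact (hB.comp (contDiff_const_smul _)).const_smul _
  · intro t ht
    have h1 : b (ε⁻¹ • t) = 1 := by
      apply b.one_of_mem_closedBall
      rw [mem_closedBall_zero_iff, norm_smul, norm_inv, Real.norm_of_nonneg hε.le]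
      exact inv_mul_le_one_of_le₀ ht hε.le
    simp [B, h1, smul_smul, hε.ne']
  · intro t ht
    have h1 : b (ε⁻¹ • t) = 0 := by
      apply b.zero_of_le_dist
      rw [dist_zero_right, norm_smul, norm_inv, Real.norm_of_nonneg hε.le, ← div_eq_inv_mul,
        le_div_iff₀ hε]
      exact ht
    simp [B, h1]
  · intro t
    have h1 : ‖ε • B (ε⁻¹ • t)‖ = b (ε⁻¹ • t) * ‖t‖ := by
      simp only [B, smul_neg, norm_neg, norm_smul, norm_inv, Real.norm_of_nonneg hε.le,
        Real.norm_of_nonneg b.nonneg]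
      field_simp
    rw [h1]
    gcongr
    exact b.le_one.trans (le_max_right _ _)
  · intro t
    have h1 : HasFDerivAt (fun t => ε • B (ε⁻¹ • t))
        (ε • (fderiv ℝ B (ε⁻¹ • t)).comp (ε⁻¹ • ContinuousLinearMap.id ℝ 𝕜)) t :=
      (((hB.differentiable (by simp)).differentiableAt.hasFDerivAt).comp t
        ((hasFDerivAt_id t).const_smul ε⁻¹)).const_smul ε
    rw [h1.fderiv, ContinuousLinearMap.comp_smul, smul_smul, mul_inv_cancel₀ hε.ne', one_smul,
      ContinuousLinearMap.comp_id]
    exact (hC' _).trans (le_max_left _ _)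

section Approximation

variable {X : Type*} [TopologicalSpace X] [ChartedSpace ℂ X] [IsManifold 𝓘(ℂ, ℂ) ω X]
  [RiemannianBundle (fun x : X => TangentSpace 𝓘(ℝ, ℂ) x)]
  [IsContMDiffRiemannianBundle 𝓘(ℝ, ℂ) ∞ ℂ (fun x : X => TangentSpace 𝓘(ℝ, ℂ) x)]
  [MeasurableSpace X] [BorelSpace X] [CompactSpace X] {𝕜 : Type*} [RCLike 𝕜]

theorem integrable_energyDensity (h : ℝ) {φ : X → 𝕜} (hφ : ContMDiff 𝓘(ℝ, ℂ) 𝓘(ℝ, 𝕜) ∞ φ) :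
    Integrable (energyDensity h φ) (riemannianVolume X) := by
  have := isFiniteMeasure_riemannianVolume (X := X)
  exact (continuous_energyDensity h hφ).integrable_of_hasCompactSupport
    (HasCompactSupport.of_compactSpace _)

/-- The truncation `ψ + H n ∘ ψ` vanishes near every boundary point, so cutting it off outside `M`
keeps it smooth with support in the interior. The error on `M` is `H n ∘ ψ`, whose energy is
dominated by `C²` times that of `ψ` and tends to zero almost everywhere. -/
theorem exists_testFunctions_tendsto {M : Set X} (hM : IsClosed M)
    (hMnull : riemannianVolume X (frontier M) = 0) (h : ℝ) {ψ : X → 𝕜}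
    (hψ : ContMDiff 𝓘(ℝ, ℂ) 𝓘(ℝ, 𝕜) ∞ ψ) (hψ0 : ∀ x ∈ frontier M, ψ x = 0) :
    ∃ χ : ℕ → X → 𝕜, (∀ n, χ n ∈ testFunctions 𝕜 M) ∧
      Tendsto (fun n => smoothH1Norm h M (χ n - ψ)) atTop (𝓝 0) := by
  have hd : MDifferentiable 𝓘(ℝ, ℂ) 𝓘(ℝ, 𝕜) ψ := hψ.mdifferentiable (by simp)
  obtain ⟨C, hC⟩ := exists_cutoff 𝕜
  set ε : ℕ → ℝ := fun n => 1 / ((n : ℝ) + 1) with hε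
  have hεpos (n : ℕ) : 0 < ε n := by positivity
  have hεlim : Tendsto (fun n => 2 * ε n) atTop (𝓝 0) := by
    simpa [hε] using (tendsto_one_div_add_atTop_nhds_zero_nat (𝕜 := ℝ)).const_mul 2
  choose H hH hHin hHout hHC hHd using fun n => hC (ε n) (hεpos n)
  have hHψ (n : ℕ) : ContMDiff 𝓘(ℝ, ℂ) 𝓘(ℝ, 𝕜) ∞ (H n ∘ ψ) := (hH n).contMDiff.comp hψ
  set χ : ℕ → X → 𝕜 := fun n => M.indicator (ψ + H n ∘ ψ) with hχ
  have hχint (n : ℕ) {x : X} (hx : x ∈ interior M) : χ n =ᶠ[𝓝 x] ψ + H n ∘ ψ := by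
    filter_upwards [isOpen_interior.mem_nhds hx] with y hy
    exact Set.indicator_of_mem (interior_subset hy) _
  have hχout (n : ℕ) {x : X} (hx : x ∉ interior M) : χ n =ᶠ[𝓝 x] 0 := by
    by_cases hxM : x ∈ M
    · have h0 : ψ x = 0 := hψ0 x ⟨subset_closure hxM, hx⟩
      have hnear : ∀ᶠ y in 𝓝 x, ‖ψ y‖ < ε n :=
        hψ.continuous.norm.continuousAt.eventually_lt continuousAt_const (by simp [h0, hεpos])
      filter_upwards [hnear] with y hy
      have : (ψ + H n ∘ ψ) y = 0 := by simp [hHin n _ hy.le]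
      exact Set.indicator_apply_eq_zero.2 fun _ => this
    · filter_upwards [hM.isOpen_compl.mem_nhds hxM] with y hy
      exact Set.indicator_of_notMem hy _
  have hχs (n : ℕ) : ContMDiff 𝓘(ℝ, ℂ) 𝓘(ℝ, 𝕜) ∞ (χ n) := by
    intro x
    by_cases hx : x ∈ interior M
    · exact (hψ.add (hHψ n) x).congr_of_eventuallyEq (hχint n hx)
    · exact (contMDiffAt_const (c := (0 : 𝕜))).congr_of_eventuallyEq (hχout n hx)
  refine ⟨χ, fun n => ⟨hχs n, HasCompactSupport.of_compactSpace _, ?_⟩, ?_⟩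
  · intro x hx
    by_contra hxi
    exact (notMem_tsupport_iff_eventuallyEq.2 (hχout n hxi)) hx
  have hlim : Tendsto (fun n => ∫ x in M, energyDensity h (χ n - ψ) x ∂riemannianVolume X) atTop
      (𝓝 (∫ x in M, (0 : ℝ) ∂riemannianVolume X)) := by
    have hae : ∀ᵐ x ∂(riemannianVolume X).restrict M,
        x ∈ interior M ∧ (ψ x = 0 → normSqDifferential ψ x = 0) := by
      filter_upwards [ae_restrict_mem hM.measurableSet,
        ae_restrict_of_ae (measure_eq_zero_iff_ae_notMem.1 hMnull),
        ae_restrict_of_ae (ae_normSqDifferential_eq_zero hψ)] with x hx hxf hx0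
      refine ⟨?_, hx0⟩
      by_contra hxi
      exact hxf ⟨subset_closure hx, hxi⟩
    have hloc (n : ℕ) {x : X} (hx : x ∈ interior M) :
        energyDensity h (χ n - ψ) x = energyDensity h (H n ∘ ψ) x := by
      refine energyDensity_congr ?_
      filter_upwards [hχint n hx] with y hy
      simp [hy]
    refine tendsto_integral_of_dominated_convergence (fun x => C ^ 2 * energyDensity h ψ x)
      (fun n => (continuous_energyDensity h ((hχs n).sub hψ)).aestronglyMeasurable)
      ((integrable_energyDensity h hψ).restrict.const_mul _) (fun n => ?_) ?_
    · filter_upwards [hae] with x hx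
      rw [Real.norm_of_nonneg (energyDensity_nonneg _ _ _), hloc n hx.1]
      exact energyDensity_comp_le h (hd x) ((hH n).differentiable (by simp) _) (hHC n _) (hHd n _)
    · filter_upwards [hae] with x hx
      refine tendsto_const_nhds.congr' ?_
      -- Where `ψ x = 0` the error is `-ψ` near `x` for every `n`; its energy there is zero only
      -- because `dψ` vanishes almost everywhere on the zero set. Where `ψ x ≠ 0` the error is
      -- eventually zero near `x`.
      by_cases h0 : ψ x = 0
      · refine Eventually.of_forall fun n => ?_
        have hnear : ∀ᶠ y in 𝓝 x, ‖ψ y‖ < ε n :=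
          hψ.continuous.norm.continuousAt.eventually_lt continuousAt_const (by simp [h0, hεpos])
        have h1 : H n ∘ ψ =ᶠ[𝓝 x] (-1 : ℝ) • ψ := by
          filter_upwards [hnear] with y hy
          simp [hHin n _ hy.le]
        change 0 = energyDensity h (χ n - ψ) x
        rw [hloc n hx.1, energyDensity_congr h1, energyDensity_smul _ _ (hd x), energyDensity,
          h0, hx.2 h0]
        simp
      · filter_upwards [hεlim.eventually_lt_const (norm_pos_iff.2 h0)] with n hn
        have hnear : ∀ᶠ y in 𝓝 x, 2 * ε n < ‖ψ y‖ :=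
          continuousAt_const.eventually_lt hψ.continuous.norm.continuousAt hn
        have h1 : H n ∘ ψ =ᶠ[𝓝 x] 0 := by
          filter_upwards [hnear] with y hy
          simp [hHout n _ hy.le]
        change 0 = energyDensity h (χ n - ψ) x
        rw [hloc n hx.1, energyDensity_congr h1, energyDensity_zero]
  rw [integral_zero] at hlim
  have hsqrt := hlim.sqrt
  rw [Real.sqrt_zero] at hsqrt
  exact hsqrt

end Approximation

/-! ### Seminorm properties of the `H¹` norm, and finiteness of the dual norm. -/

section Norms

variable {X : Type*} [TopologicalSpace X] [ChartedSpace ℂ X] {𝕜 : Type*} [RCLike 𝕜]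

theorem contMDiff_const_smul (c : ℝ) {φ : X → 𝕜} (hφ : ContMDiff 𝓘(ℝ, ℂ) 𝓘(ℝ, 𝕜) ∞ φ) :
    ContMDiff 𝓘(ℝ, ℂ) 𝓘(ℝ, 𝕜) ∞ (c • φ) :=
  (contDiff_const_smul c).contMDiff.comp hφ

theorem contMDiff_sub {φ ψ : X → 𝕜} (hφ : ContMDiff 𝓘(ℝ, ℂ) 𝓘(ℝ, 𝕜) ∞ φ)
    (hψ : ContMDiff 𝓘(ℝ, ℂ) 𝓘(ℝ, 𝕜) ∞ ψ) : ContMDiff 𝓘(ℝ, ℂ) 𝓘(ℝ, 𝕜) ∞ (φ - ψ) :=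
  hφ.sub hψ

variable [IsManifold 𝓘(ℂ, ℂ) ω X] [RiemannianBundle (fun x : X => TangentSpace 𝓘(ℝ, ℂ) x)]
  [IsContMDiffRiemannianBundle 𝓘(ℝ, ℂ) ∞ ℂ (fun x : X => TangentSpace 𝓘(ℝ, ℂ) x)]
  [MeasurableSpace X] [BorelSpace X] [CompactSpace X]

theorem smoothH1Norm_nonneg (h : ℝ) (D : Set X) (φ : X → 𝕜) : 0 ≤ smoothH1Norm h D φ :=
  Real.sqrt_nonneg _

theorem smoothH1Norm_sq (h : ℝ) (D : Set X) (φ : X → 𝕜) :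
    smoothH1Norm h D φ ^ 2 = ∫ x in D, energyDensity h φ x ∂riemannianVolume X :=
  Real.sq_sqrt (integral_nonneg fun x => energyDensity_nonneg h φ x)

theorem smoothH1Norm_smul (h : ℝ) (D : Set X) (c : ℝ) {φ : X → 𝕜}
    (hφ : ContMDiff 𝓘(ℝ, ℂ) 𝓘(ℝ, 𝕜) ∞ φ) :
    smoothH1Norm h D (c • φ) = |c| * smoothH1Norm h D φ := by
  have hd : MDifferentiable 𝓘(ℝ, ℂ) 𝓘(ℝ, 𝕜) φ := hφ.mdifferentiable (by simp)
  rw [← abs_of_nonneg (smoothH1Norm_nonneg h D φ), ← abs_mul,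
    ← abs_of_nonneg (smoothH1Norm_nonneg h D (c • φ)), ← sq_eq_sq_iff_abs_eq_abs, mul_pow,
    smoothH1Norm_sq, smoothH1Norm_sq, ← integral_const_mul]
  simp_rw [fun x => energyDensity_smul h c (hd x)]

theorem smoothH1Norm_add_le (h : ℝ) (D : Set X) {φ ψ : X → 𝕜}
    (hφ : ContMDiff 𝓘(ℝ, ℂ) 𝓘(ℝ, 𝕜) ∞ φ) (hψ : ContMDiff 𝓘(ℝ, ℂ) 𝓘(ℝ, 𝕜) ∞ ψ) :
    smoothH1Norm h D (φ + ψ) ≤ smoothH1Norm h D φ + smoothH1Norm h D ψ := by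
  have hφd : MDifferentiable 𝓘(ℝ, ℂ) 𝓘(ℝ, 𝕜) φ := hφ.mdifferentiable (by simp)
  have hψd : MDifferentiable 𝓘(ℝ, ℂ) 𝓘(ℝ, 𝕜) ψ := hψ.mdifferentiable (by simp)
  -- Strict bounds keep `s` and `r` positive. The weight `δ = r / s` is the optimal one: the two
  -- terms add up to exactly `(s + r)²`.
  have key {s r : ℝ} (hs : smoothH1Norm h D φ < s) (hr : smoothH1Norm h D ψ < r) :
      smoothH1Norm h D (φ + ψ) ≤ s + r := by
    have hs0 : 0 < s := (smoothH1Norm_nonneg _ _ _).trans_lt hs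
    have hr0 : 0 < r := (smoothH1Norm_nonneg _ _ _).trans_lt hr
    refine (sq_le_sq₀ (smoothH1Norm_nonneg _ _ _) (by positivity)).1 ?_
    have h1 : smoothH1Norm h D (φ + ψ) ^ 2
        ≤ (1 + r / s) * smoothH1Norm h D φ ^ 2 + (1 + (r / s)⁻¹) * smoothH1Norm h D ψ ^ 2 := by
      rw [smoothH1Norm_sq, smoothH1Norm_sq, smoothH1Norm_sq, ← integral_const_mul,
        ← integral_const_mul, ← integral_add ((integrable_energyDensity h hφ).restrict.const_mul _)
          ((integrable_energyDensity h hψ).restrict.const_mul _)]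
      exact integral_mono (integrable_energyDensity h (hφ.add hψ)).restrict
        (((integrable_energyDensity h hφ).restrict.const_mul _).add
          ((integrable_energyDensity h hψ).restrict.const_mul _))
        fun x => energyDensity_add_le h (hφd x) (hψd x) (by positivity)
    have h2 : smoothH1Norm h D φ ^ 2 ≤ s ^ 2 := by
      have := smoothH1Norm_nonneg h D φ
      gcongr
    have h3 : smoothH1Norm h D ψ ^ 2 ≤ r ^ 2 := by
      have := smoothH1Norm_nonneg h D ψ
      gcongr
    calc _ ≤ _ := h1
      _ ≤ (1 + r / s) * s ^ 2 + (1 + (r / s)⁻¹) * r ^ 2 := by gcongr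
      _ = (s + r) ^ 2 := by
        field_simp
        ring
  refine le_of_forall_pos_le_add fun ε hε => ?_
  have := key (lt_add_of_pos_right (smoothH1Norm h D φ) (half_pos hε))
    (lt_add_of_pos_right (smoothH1Norm h D ψ) (half_pos hε))
  linarith

theorem smoothH1Norm_sub_comm (h : ℝ) (D : Set X) {φ ψ : X → 𝕜}
    (hφ : ContMDiff 𝓘(ℝ, ℂ) 𝓘(ℝ, 𝕜) ∞ φ) (hψ : ContMDiff 𝓘(ℝ, ℂ) 𝓘(ℝ, 𝕜) ∞ ψ) :
    smoothH1Norm h D (φ - ψ) = smoothH1Norm h D (ψ - φ) := by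
  have h1 : φ - ψ = (-1 : ℝ) • (ψ - φ) := by simp
  rw [h1, smoothH1Norm_smul h D _ (contMDiff_sub hψ hφ)]
  simp

theorem abs_smoothH1Norm_sub_le (h : ℝ) (D : Set X) {φ ψ : X → 𝕜}
    (hφ : ContMDiff 𝓘(ℝ, ℂ) 𝓘(ℝ, 𝕜) ∞ φ) (hψ : ContMDiff 𝓘(ℝ, ℂ) 𝓘(ℝ, 𝕜) ∞ ψ) :
    |smoothH1Norm h D φ - smoothH1Norm h D ψ| ≤ smoothH1Norm h D (φ - ψ) := by
  have h1 := smoothH1Norm_add_le h D (contMDiff_sub hφ hψ) hψ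
  have h2 := smoothH1Norm_add_le h D (contMDiff_sub hψ hφ) hφ
  rw [smoothH1Norm_sub_comm h D hψ hφ] at h2
  rw [sub_add_cancel] at h1 h2
  exact abs_sub_le_iff.2 ⟨sub_le_iff_le_add.2 h1, sub_le_iff_le_add.2 h2⟩

theorem memLp_of_contMDiff {φ : X → 𝕜} (hφ : ContMDiff 𝓘(ℝ, ℂ) 𝓘(ℝ, 𝕜) ∞ φ) :
    MemLp φ 2 (riemannianVolume X) := by
  have := isFiniteMeasure_riemannianVolume (X := X)
  exact hφ.continuous.memLp_of_hasCompactSupport (HasCompactSupport.of_compactSpace _)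

theorem eLpNorm_le_smoothH1Norm (h : ℝ) (D : Set X) {φ : X → 𝕜}
    (hφ : ContMDiff 𝓘(ℝ, ℂ) 𝓘(ℝ, 𝕜) ∞ φ) :
    eLpNorm φ 2 ((riemannianVolume X).restrict D) ≤ ENNReal.ofReal (smoothH1Norm h D φ) := by
  have hm := (memLp_of_contMDiff hφ).restrict D
  rw [hm.eLpNorm_eq_integral_rpow_norm two_ne_zero ENNReal.ofNat_ne_top]
  refine ENNReal.ofReal_le_ofReal ?_
  rw [ENNReal.toReal_ofNat, ← one_div, ← Real.sqrt_eq_rpow]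
  refine Real.sqrt_le_sqrt ?_
  refine integral_mono (by simpa using hm.integrable_norm_pow two_ne_zero)
    (integrable_energyDensity h hφ).restrict fun x => ?_
  simp only [Real.rpow_ofNat]
  exact le_add_of_nonneg_right (mul_nonneg (sq_nonneg _) (normSqDifferential_nonneg _ _))

theorem HasH1Norm.eLpNorm_le {h : ℝ} {D : Set X} {v : X → 𝕜} {N : ℝ}
    (hv : HasH1Norm (smoothFunctions X 𝕜) h D v N) :
    eLpNorm v 2 ((riemannianVolume X).restrict D) ≤ ENNReal.ofReal N := by
  obtain ⟨hvm, φ, hφ, hlim, -, hN⟩ := hv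
  have h1 : Tendsto (fun n => ENNReal.ofReal (smoothH1Norm h D (φ n))
      + eLpNorm (φ n - v) 2 ((riemannianVolume X).restrict D)) atTop
      (𝓝 (ENNReal.ofReal N + 0)) :=
    (ENNReal.tendsto_ofReal hN).add hlim
  rw [add_zero] at h1
  refine ge_of_tendsto' h1 fun n => ?_
  have h2 : v = φ n - (φ n - v) := by simp
  have hφm := ((memLp_of_contMDiff (hφ n)).restrict D).aestronglyMeasurable
  calc eLpNorm v 2 _ = eLpNorm (φ n - (φ n - v)) 2 _ := by rw [← h2]
    _ ≤ eLpNorm (φ n) 2 _ + eLpNorm (φ n - v) 2 _ :=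
      eLpNorm_sub_le hφm (hφm.sub hvm.aestronglyMeasurable) one_le_two
    _ ≤ _ := by
      gcongr
      exact eLpNorm_le_smoothH1Norm h D (hφ n)

/-- By Cauchy–Schwarz the dual norm is at most the `L²` norm of `u`, since the `H¹` norm dominates
the `L²` norm. -/
theorem closedHNegOneNorm_ne_top (h : ℝ) {u : X → 𝕜} (hu : ContMDiff 𝓘(ℝ, ℂ) 𝓘(ℝ, 𝕜) ∞ u) :
    closedHNegOneNorm h u ≠ ⊤ := by
  have hum := memLp_of_contMDiff hu
  refine ne_top_of_le_ne_top hum.eLpNorm_ne_top ?_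
  refine iSup_le fun v => iSup_le fun N => iSup_le fun hv => iSup_le fun hN => ?_
  have hv2 := hv.eLpNorm_le
  have hvm := hv.1
  rw [Measure.restrict_univ] at hv2 hvm ⊢
  calc ‖∫ x, u x * v x ∂riemannianVolume X‖ₑ
      ≤ ∫⁻ x, ‖u x * v x‖ₑ ∂riemannianVolume X := enorm_integral_le_lintegral_enorm _
    _ = eLpNorm (u • v) 1 (riemannianVolume X) := by
      rw [eLpNorm_one_eq_lintegral_enorm]
      rfl
    _ ≤ eLpNorm u 2 (riemannianVolume X) * eLpNorm v 2 (riemannianVolume X) :=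
      eLpNorm_smul_le_mul_eLpNorm hvm.aestronglyMeasurable hum.aestronglyMeasurable
    _ ≤ eLpNorm u 2 (riemannianVolume X) * 1 := by
      gcongr
      exact hv2.trans (ENNReal.ofReal_le_one.2 hN)
    _ = eLpNorm u 2 (riemannianVolume X) := mul_one _

end Norms

/-! ### Odd parts -/

section OddPart

variable {X : Type*} {𝕜 : Type*} [RCLike 𝕜]

/-- The odd part of `f` under `R`, normalized by `√2` instead of `2`. -/
def oddPart (R : X → X) (f : X → 𝕜) : X → 𝕜 :=
  (√2)⁻¹ • (f - f ∘ R)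

theorem oddPart_sub (R : X → X) (f g : X → 𝕜) :
    oddPart R (f - g) = oddPart R f - oddPart R g := by
  ext x
  simp only [oddPart, Pi.smul_apply, Pi.sub_apply, Function.comp_apply, ← smul_sub]
  congr 1
  ring

theorem oddPart_apply_image {R : X → X} (hR : Function.Involutive R) (f : X → 𝕜) (x : X) :
    oddPart R f (R x) = -oddPart R f x := by
  simp [oddPart, hR x, ← smul_neg]

theorem oddPart_apply_of_fixed {R : X → X} (f : X → 𝕜) {x : X} (hx : R x = x) :
    oddPart R f x = 0 := by
  simp [oddPart, hx]

variable [MeasurableSpace X] {μ : Measure X}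

theorem memLp_oddPart {R : X → X} (hR : MeasurePreserving R μ μ) {f : X → 𝕜} (hf : MemLp f 2 μ) :
    MemLp (oddPart R f) 2 μ :=
  (hf.sub (hf.comp_measurePreserving hR)).const_smul _

/-- The constant is not sharp; it only serves to pass `L²` limits through `oddPart`. -/
theorem eLpNorm_oddPart_le {R : X → X} (hR : MeasurePreserving R μ μ) {f : X → 𝕜}
    (hf : AEStronglyMeasurable f μ) : eLpNorm (oddPart R f) 2 μ ≤ 2 * eLpNorm f 2 μ := by
  have h1 : ‖(√2)⁻¹‖ₑ ≤ 1 := by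
    rw [Real.enorm_of_nonneg (by positivity), ENNReal.ofReal_le_one]
    exact inv_le_one_of_one_le₀ (Real.one_le_sqrt.2 one_le_two)
  calc eLpNorm (oddPart R f) 2 μ = ‖(√2)⁻¹‖ₑ * eLpNorm (f - f ∘ R) 2 μ :=
      eLpNorm_const_smul _ _ _ _
    _ ≤ 1 * (eLpNorm f 2 μ + eLpNorm (f ∘ R) 2 μ) := by
      gcongr
      exact eLpNorm_sub_le hf (hf.comp_measurePreserving hR) one_le_two
    _ = 2 * eLpNorm f 2 μ := by
      rw [eLpNorm_comp_measurePreserving hf hR, one_mul, two_mul]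

/-- The substitution `x ↦ R x` turns `∫ u (f ∘ R)` into `-∫ u f`, so the pairing is `2 / √2` times
`∫ u f`. -/
theorem integral_mul_oddPart {R : X → X} (hR : MeasurePreserving R μ μ)
    (hinv : Function.Involutive R) {u f : X → 𝕜} (hu : MemLp u 2 μ) (hf : MemLp f 2 μ)
    (hodd : ∀ x, u (R x) = -u x) :
    ∫ x, u x * oddPart R f x ∂μ = √2 • ∫ x, u x * f x ∂μ := by
  have h1 : ∫ x, u x * f (R x) ∂μ = -∫ x, u x * f x ∂μ := by
    have h2 := hR.integral_comp' (f := MeasurableEquiv.ofInvolutive R hinv hR.measurable)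
      (fun x => u x * f x)
    rw [← h2, ← integral_neg]
    refine integral_congr_ae (Eventually.of_forall fun x => ?_)
    simp [hodd]
  have h3 : Integrable (fun x => u x * f x) μ := hu.integrable_mul hf
  have h4 : Integrable (fun x => u x * f (R x)) μ :=
    hu.integrable_mul (hf.comp_measurePreserving hR)
  calc ∫ x, u x * oddPart R f x ∂μ = ∫ x, (√2)⁻¹ • (u x * f x - u x * f (R x)) ∂μ := by
        simp [oddPart, mul_sub]
    _ = (√2)⁻¹ • (2 : ℝ) • ∫ x, u x * f x ∂μ := by
        rw [integral_smul, integral_sub h3 h4, h1, sub_neg_eq_add, two_smul]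
    _ = √2 • ∫ x, u x * f x ∂μ := by
        rw [smul_smul, ← div_eq_inv_mul, Real.div_sqrt]

end OddPart

/-! ### Doubles -/

section Double

variable {X : Type*} [TopologicalSpace X] [ChartedSpace ℂ X] [IsManifold 𝓘(ℂ, ℂ) ω X]
  [RiemannianBundle (fun x : X => TangentSpace 𝓘(ℝ, ℂ) x)]
  [IsContMDiffRiemannianBundle 𝓘(ℝ, ℂ) ∞ ℂ (fun x : X => TangentSpace 𝓘(ℝ, ℂ) x)]
  [MeasurableSpace X] [BorelSpace X] [CompactSpace X] {𝕜 : Type*} [RCLike 𝕜]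
  {M : Set X} {R : X → X}

theorem IsDouble.mdifferentiable (hdouble : IsDouble M R) :
    MDifferentiable 𝓘(ℝ, ℂ) 𝓘(ℝ, ℂ) R :=
  hdouble.smooth.mdifferentiable (by simp)

theorem IsDouble.measurePreserving (hdouble : IsDouble M R) :
    MeasurePreserving R (riemannianVolume X) (riemannianVolume X) :=
  map_riemannianVolume hdouble.mdifferentiable hdouble.isometric hdouble.involutive

theorem IsDouble.contMDiff_oddPart (hdouble : IsDouble M R) {φ : X → 𝕜}
    (hφ : ContMDiff 𝓘(ℝ, ℂ) 𝓘(ℝ, 𝕜) ∞ φ) : ContMDiff 𝓘(ℝ, ℂ) 𝓘(ℝ, 𝕜) ∞ (oddPart R φ) :=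
  contMDiff_const_smul _ (contMDiff_sub hφ (hφ.comp hdouble.smooth))

theorem IsDouble.notMem_interior (hdouble : IsDouble M R) {x : X} (hx : x ∈ M) :
    R x ∉ interior M := by
  intro h
  have h1 : R x ∈ frontier M := hdouble.inter_eq ▸ ⟨interior_subset h, x, hx, rfl⟩
  exact h1.2 h

/-- The complement of `M` and `R⁻¹(M)` differ only by the null boundary, so both halves contribute
equally. -/
theorem IsDouble.integral_eq_two_mul (hdouble : IsDouble M R) {E : Type*} [NormedAddCommGroup E]
    [NormedSpace ℝ E] {f : X → E} (hf : Integrable f (riemannianVolume X))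
    (hR : ∀ x, f (R x) = f x) :
    ∫ x, f x ∂riemannianVolume X = (2 : ℝ) • ∫ x in M, f x ∂riemannianVolume X := by
  have hpre : R ⁻¹' M = R '' M := congrFun (Set.image_eq_preimage_of_inverse
    hdouble.involutive.leftInverse hdouble.involutive.rightInverse).symm M
  have hae : (Mᶜ : Set X) =ᵐ[riemannianVolume X] R ⁻¹' M := by
    rw [hpre]
    have h0 := measure_eq_zero_iff_ae_notMem.1 (riemannianVolume_frontier hdouble)
    filter_upwards [h0] with x hx
    rw [← hdouble.inter_eq] at hx
    have hx' : x ∈ M ∪ R '' M := hdouble.union_eq ▸ Set.mem_univ x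
    refine propext ⟨fun h => hx'.resolve_left h, fun h hM => hx ⟨hM, h⟩⟩
  have hemb := (MeasurableEquiv.ofInvolutive R hdouble.involutive
    hdouble.measurePreserving.measurable).measurableEmbedding
  have h1 := hdouble.measurePreserving.setIntegral_preimage_emb hemb f M
  simp only [hR] at h1
  rw [← integral_add_compl hdouble.isClosed.measurableSet hf, setIntegral_congr_set hae, h1,
    two_smul]

theorem IsDouble.smoothH1Norm_oddPart_le (hdouble : IsDouble M R) (h : ℝ) {φ : X → 𝕜}
    (hφ : ContMDiff 𝓘(ℝ, ℂ) 𝓘(ℝ, 𝕜) ∞ φ) :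
    smoothH1Norm h M (oddPart R φ) ≤ smoothH1Norm h Set.univ φ := by
  have hφR := hφ.comp hdouble.smooth
  have hφd : MDifferentiable 𝓘(ℝ, ℂ) 𝓘(ℝ, 𝕜) φ := hφ.mdifferentiable (by simp)
  have hφRd : MDifferentiable 𝓘(ℝ, ℂ) 𝓘(ℝ, 𝕜) (φ ∘ R) := hφR.mdifferentiable (by simp)
  have hodd := hdouble.contMDiff_oddPart hφ
  have hoddd : MDifferentiable 𝓘(ℝ, ℂ) 𝓘(ℝ, 𝕜) (oddPart R φ) := hodd.mdifferentiable (by simp)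
  have hpt (x : X) : energyDensity h (oddPart R φ) x
      ≤ energyDensity h φ x + energyDensity h φ (R x) := by
    -- With `δ = 1` both weights are `2`, which the square of the factor `1 / √2` cancels.
    have h1 := energyDensity_add_le h (hφd x) ((contMDiff_const_smul (-1) hφR).mdifferentiable
      (by simp) x) one_pos
    rw [energyDensity_smul _ _ (hφRd x),
      energyDensity_comp hdouble.mdifferentiable hdouble.isometric h hφd] at h1
    have h2 : oddPart R φ = (√2)⁻¹ • (φ + (-1 : ℝ) • (φ ∘ R)) := by
      simp [oddPart, sub_eq_add_neg]
    rw [h2, energyDensity_smul _ _ ((hφ.add (contMDiff_const_smul (-1) hφR)).mdifferentiable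
      (by simp) x), inv_pow, Real.sq_sqrt zero_le_two]
    linarith
  have hinv (x : X) : energyDensity h (oddPart R φ) (R x) = energyDensity h (oddPart R φ) x := by
    rw [← energyDensity_comp hdouble.mdifferentiable hdouble.isometric h hoddd]
    have h1 : oddPart R φ ∘ R = (-1 : ℝ) • oddPart R φ := by
      ext y
      simp [oddPart_apply_image hdouble.involutive]
    rw [h1, energyDensity_smul _ _ (hoddd x)]
    simp
  refine Real.sqrt_le_sqrt ?_
  change ∫ x in M, energyDensity h (oddPart R φ) x ∂riemannianVolume X
    ≤ ∫ x in Set.univ, energyDensity h φ x ∂riemannianVolume X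
  have hi := integrable_energyDensity h hφ
  have hiR : Integrable (fun x => energyDensity h φ (R x)) (riemannianVolume X) :=
    hdouble.measurePreserving.integrable_comp_of_integrable hi
  have h1 := hdouble.integral_eq_two_mul (integrable_energyDensity h hodd) hinv
  have h2 := integral_mono (integrable_energyDensity h hodd) (hi.add hiR) hpt
  have h3 := hdouble.measurePreserving.integral_comp' (f := MeasurableEquiv.ofInvolutive R
    hdouble.involutive hdouble.measurePreserving.measurable) (energyDensity h φ)
  change ∫ x, energyDensity h φ (R x) ∂riemannianVolume X = _ at h3
  have h4 := integral_add hi hiR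
  simp only [Pi.add_apply, smul_eq_mul] at h1 h2
  rw [Measure.restrict_univ]
  linarith

/-- The supports of `φ` and `φ ∘ R` are disjoint, so there is no cross term: each contributes half
of the energy of `φ`. -/
theorem IsDouble.smoothH1Norm_oddPart_of_tsupport_subset (hdouble : IsDouble M R) (h : ℝ)
    {φ : X → 𝕜} (hφ : ContMDiff 𝓘(ℝ, ℂ) 𝓘(ℝ, 𝕜) ∞ φ) (hs : tsupport φ ⊆ interior M) :
    smoothH1Norm h Set.univ (oddPart R φ) = smoothH1Norm h M φ := by
  have hφR := hφ.comp hdouble.smooth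
  have hφd : MDifferentiable 𝓘(ℝ, ℂ) 𝓘(ℝ, 𝕜) φ := hφ.mdifferentiable (by simp)
  have hφRd : MDifferentiable 𝓘(ℝ, ℂ) 𝓘(ℝ, 𝕜) (φ ∘ R) := hφR.mdifferentiable (by simp)
  have hzero {x : X} (hx : x ∉ tsupport φ) : energyDensity h φ x = 0 := by
    rw [energyDensity_congr (notMem_tsupport_iff_eventuallyEq.1 hx), energyDensity_zero]
  have hpt (x : X) : energyDensity h (oddPart R φ) x
      = 2⁻¹ * (energyDensity h φ x + energyDensity h φ (R x)) := by
    by_cases hx : x ∈ tsupport φ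
    · have hRx : R x ∉ tsupport φ :=
        fun h => hdouble.notMem_interior (interior_subset (hs hx)) (hs h)
      have h1 : oddPart R φ =ᶠ[𝓝 x] (√2)⁻¹ • φ := by
        filter_upwards [hdouble.smooth.continuous.continuousAt.eventually
          (notMem_tsupport_iff_eventuallyEq.1 hRx)] with y hy
        simp only [Pi.zero_apply] at hy
        simp [oddPart, hy]
      rw [energyDensity_congr h1, energyDensity_smul _ _ (hφd x), hzero hRx, inv_pow,
        Real.sq_sqrt zero_le_two, add_zero]
    · have h1 : oddPart R φ =ᶠ[𝓝 x] (-(√2)⁻¹) • (φ ∘ R) := by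
        filter_upwards [notMem_tsupport_iff_eventuallyEq.1 hx] with y hy
        simp only [Pi.zero_apply] at hy
        simp [oddPart, hy]
      rw [energyDensity_congr h1, energyDensity_smul _ _ (hφRd x), hzero hx,
        energyDensity_comp hdouble.mdifferentiable hdouble.isometric h hφd, neg_sq, inv_pow,
        Real.sq_sqrt zero_le_two, zero_add]
  have hi := integrable_energyDensity h hφ
  have hiR : Integrable (fun x => energyDensity h φ (R x)) (riemannianVolume X) :=
    hdouble.measurePreserving.integrable_comp_of_integrable hi
  have h3 := hdouble.measurePreserving.integral_comp' (f := MeasurableEquiv.ofInvolutive R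
    hdouble.involutive hdouble.measurePreserving.measurable) (energyDensity h φ)
  change ∫ x, energyDensity h φ (R x) ∂riemannianVolume X = _ at h3
  change √(∫ x in Set.univ, energyDensity h (oddPart R φ) x ∂riemannianVolume X)
    = √(∫ x in M, energyDensity h φ x ∂riemannianVolume X)
  rw [Measure.restrict_univ, setIntegral_eq_integral_of_forall_compl_eq_zero
    (fun x hx => hzero fun h => hx (interior_subset (hs h)))]
  simp_rw [hpt]
  rw [integral_const_mul, integral_add hi hiR, h3]
  ring_nf

theorem IsDouble.hasH1Norm_oddPart_indicator (hdouble : IsDouble M R) {h : ℝ} {v : X → 𝕜} {N : ℝ}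
    (hv : HasH1Norm (testFunctions 𝕜 M) h M v N) :
    HasH1Norm (smoothFunctions X 𝕜) h Set.univ (oddPart R (M.indicator v)) N := by
  obtain ⟨hvm, φ, hφ, hlim, hcauchy, hN⟩ := hv
  have hM := hdouble.isClosed.measurableSet
  have hvM : MemLp (M.indicator v) 2 (riemannianVolume X) :=
    (memLp_indicator_iff_restrict hM).2 hvm
  have hsub (m n : ℕ) : tsupport (φ m - φ n) ⊆ interior M :=
    (tsupport_sub _ _).trans (Set.union_subset (hφ m).2.2 (hφ n).2.2)
  refine ⟨?_, fun n => oddPart R (φ n), fun n => hdouble.contMDiff_oddPart (hφ n).1, ?_, ?_, ?_⟩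
  · rw [Measure.restrict_univ]
    exact memLp_oddPart hdouble.measurePreserving hvM
  · have h2 := ENNReal.Tendsto.const_mul hlim (a := 2) (Or.inr ENNReal.ofNat_ne_top)
    rw [mul_zero] at h2
    refine tendsto_of_tendsto_of_tendsto_of_le_of_le tendsto_const_nhds h2
      (fun n => zero_le) fun n => ?_
    simp only
    have h3 : φ n - M.indicator v = M.indicator (φ n - v) := by
      ext x
      by_cases hx : x ∈ M
      · simp [hx]
      · simp [hx, image_eq_zero_of_notMem_tsupport
          fun h => hx (interior_subset ((hφ n).2.2 h))]
    rw [Measure.restrict_univ, ← oddPart_sub, ← eLpNorm_indicator_eq_eLpNorm_restrict hM, ← h3]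
    exact eLpNorm_oddPart_le hdouble.measurePreserving
      ((memLp_of_contMDiff (hφ n).1).sub hvM).aestronglyMeasurable
  · simp_rw [← oddPart_sub, fun m n => hdouble.smoothH1Norm_oddPart_of_tsupport_subset h
      (contMDiff_sub (hφ m).1 (hφ n).1) (hsub m n)]
    exact hcauchy
  · simp_rw [fun n => hdouble.smoothH1Norm_oddPart_of_tsupport_subset h (hφ n).1 (hφ n).2.2]
    exact hN

/-- The odd parts of an approximating sequence vanish on `∂M` but need not be test functions. Each
is replaced by a test function within `1 / (n + 1)` in `H¹(M)`, which preserves the Cauchy property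
and the `L²` limit; the norms converge because they form a Cauchy sequence. -/
theorem IsDouble.exists_hasH1Norm_oddPart (hdouble : IsDouble M R) {h : ℝ} {v : X → 𝕜} {N : ℝ}
    (hv : HasH1Norm (smoothFunctions X 𝕜) h Set.univ v N) :
    ∃ N' ≤ N, HasH1Norm (testFunctions 𝕜 M) h M (oddPart R v) N' := by
  obtain ⟨hvm, φ, hφ, hlim, hcauchy, hN⟩ := hv
  rw [Measure.restrict_univ] at hvm hlim
  have hφ' (n : ℕ) : ContMDiff 𝓘(ℝ, ℂ) 𝓘(ℝ, 𝕜) ∞ (φ n) := hφ n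
  have hodd (n : ℕ) := hdouble.contMDiff_oddPart (hφ' n)
  set ε : ℕ → ℝ := fun n => 1 / ((n : ℝ) + 1)
  have hεpos (n : ℕ) : 0 < ε n := by positivity
  have hεlim : Tendsto ε atTop (𝓝 0) := tendsto_one_div_add_atTop_nhds_zero_nat
  have hex (n : ℕ) : ∃ ψ ∈ testFunctions 𝕜 M, smoothH1Norm h M (ψ - oddPart R (φ n)) < ε n := by
    obtain ⟨χ, hχ, hχlim⟩ := exists_testFunctions_tendsto hdouble.isClosed
      (riemannianVolume_frontier hdouble) h (hodd n)
      fun x hx => oddPart_apply_of_fixed _ (hdouble.fixes_boundary x hx)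
    obtain ⟨k, hk⟩ := (hχlim.eventually_lt_const (hεpos n)).exists
    exact ⟨χ k, hχ k, hk⟩
  choose ψ hψ hψε using hex
  have hcauchy' : Tendsto (fun mn : ℕ × ℕ => smoothH1Norm h M (ψ mn.1 - ψ mn.2)) atTop (𝓝 0) := by
    have h1 : Tendsto (fun mn : ℕ × ℕ => ε mn.1 + (smoothH1Norm h Set.univ (φ mn.1 - φ mn.2)
        + ε mn.2)) atTop (𝓝 (0 + (0 + 0))) := by
      rw [← prod_atTop_atTop_eq] at hcauchy ⊢
      exact (hεlim.comp tendsto_fst).add (hcauchy.add (hεlim.comp tendsto_snd))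
    rw [add_zero, add_zero] at h1
    refine tendsto_of_tendsto_of_tendsto_of_le_of_le tendsto_const_nhds h1
      (fun mn => smoothH1Norm_nonneg _ _ _) ?_
    rintro ⟨m, n⟩
    have h2 : ψ m - ψ n = (ψ m - oddPart R (φ m))
        + (oddPart R (φ m - φ n) + (oddPart R (φ n) - ψ n)) := by
      rw [oddPart_sub]
      abel
    have h3 := contMDiff_sub (hψ m).1 (hodd m)
    have h4 := hdouble.contMDiff_oddPart (contMDiff_sub (hφ' m) (hφ' n))
    have h5 := contMDiff_sub (hodd n) (hψ n).1
    have h6 := smoothH1Norm_add_le h M h3 (h4.add h5)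
    have h7 := smoothH1Norm_add_le h M h4 h5
    have h8 := hdouble.smoothH1Norm_oddPart_le h (contMDiff_sub (hφ' m) (hφ' n))
    rw [smoothH1Norm_sub_comm h M (hodd n) (hψ n).1] at h7
    simp only
    rw [h2]
    exact h6.trans (add_le_add (hψε m).le (h7.trans (add_le_add h8 (hψε n).le)))
  have hcs : CauchySeq fun n => smoothH1Norm h M (ψ n) := by
    refine cauchySeq_iff_tendsto_dist_atTop_0.2 ?_
    exact tendsto_of_tendsto_of_tendsto_of_le_of_le tendsto_const_nhds hcauchy'
      (fun mn => dist_nonneg) fun mn => abs_smoothH1Norm_sub_le h M (hψ mn.1).1 (hψ mn.2).1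
  obtain ⟨N', hN'⟩ := cauchySeq_tendsto_of_complete hcs
  refine ⟨N', ?_, (memLp_oddPart hdouble.measurePreserving hvm).restrict M, ψ, hψ, ?_, hcauchy',
    hN'⟩
  · have h1 : Tendsto (fun n => smoothH1Norm h Set.univ (φ n) + ε n) atTop (𝓝 (N + 0)) :=
      hN.add hεlim
    rw [add_zero] at h1
    refine le_of_tendsto_of_tendsto' hN' h1 fun n => ?_
    have h2 := (le_abs_self _).trans (abs_smoothH1Norm_sub_le h M (hψ n).1 (hodd n))
    have h3 := hdouble.smoothH1Norm_oddPart_le h (hφ' n)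
    linarith [hψε n]
  · have h1 : Tendsto (fun n => ENNReal.ofReal (ε n)
        + 2 * eLpNorm (φ n - v) 2 (riemannianVolume X)) atTop
        (𝓝 (ENNReal.ofReal 0 + 2 * 0)) :=
      (ENNReal.tendsto_ofReal hεlim).add
        (ENNReal.Tendsto.const_mul hlim (Or.inr ENNReal.ofNat_ne_top))
    rw [ENNReal.ofReal_zero, mul_zero, add_zero] at h1
    refine tendsto_of_tendsto_of_tendsto_of_le_of_le tendsto_const_nhds h1
      (fun n => zero_le) fun n => ?_
    have h2 : ψ n - oddPart R v = (ψ n - oddPart R (φ n)) + oddPart R (φ n - v) := by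
      rw [oddPart_sub]
      abel
    have h3 := contMDiff_sub (hψ n).1 (hodd n)
    have h4 : MemLp (φ n - v) 2 (riemannianVolume X) := (memLp_of_contMDiff (hφ' n)).sub hvm
    simp only
    rw [h2]
    calc _ ≤ eLpNorm (ψ n - oddPart R (φ n)) 2 ((riemannianVolume X).restrict M)
        + eLpNorm (oddPart R (φ n - v)) 2 ((riemannianVolume X).restrict M) :=
          eLpNorm_add_le ((memLp_of_contMDiff h3).restrict M).aestronglyMeasurable
            ((memLp_oddPart hdouble.measurePreserving h4).restrict M).aestronglyMeasurable
            one_le_two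
      _ ≤ _ := by
        gcongr
        · exact (eLpNorm_le_smoothH1Norm h M h3).trans (ENNReal.ofReal_le_ofReal (hψε n).le)
        · exact (eLpNorm_mono_measure _ Measure.restrict_le_self).trans
            (eLpNorm_oddPart_le hdouble.measurePreserving h4.aestronglyMeasurable)

theorem IsDouble.closedHNegOneNorm_eq (hdouble : IsDouble M R) (h : ℝ) {u : X → 𝕜}
    (hu : ContMDiff 𝓘(ℝ, ℂ) 𝓘(ℝ, 𝕜) ∞ u) (hodd : ∀ x, u (R x) = -u x) :
    closedHNegOneNorm h u = ENNReal.ofReal (√2) * borderedHNegOneNorm h M u := by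
  have hum := memLp_of_contMDiff hu
  have hM := hdouble.isClosed.measurableSet
  have hsqrt : ENNReal.ofReal (√2) = ‖√2‖ₑ := (Real.enorm_of_nonneg (Real.sqrt_nonneg _)).symm
  apply le_antisymm
  · refine iSup_le fun v => iSup_le fun N => iSup_le fun hv => iSup_le fun hN => ?_
    obtain ⟨N', hN', hv'⟩ := hdouble.exists_hasH1Norm_oddPart hv
    have hvm := hv.1
    rw [Measure.restrict_univ] at hvm ⊢
    have h1 := integral_mul_oddPart hdouble.measurePreserving hdouble.involutive hum hvm hodd
    -- The product of the odd functions `u` and `oddPart R v` is even, so its integral over `X` is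
    -- twice that over `M`; dividing `√2 ∫_X u v = 2 ∫_M u (oddPart R v)` by `√2` leaves the
    -- constant `√2`.
    have h2 := hdouble.integral_eq_two_mul
      (hum.integrable_mul (memLp_oddPart hdouble.measurePreserving hvm)) fun x => by
        simp [hodd, oddPart_apply_image hdouble.involutive]
    simp only [Pi.mul_apply] at h2
    rw [h1] at h2
    have h3 : ∫ x, u x * v x ∂riemannianVolume X
        = √2 • ∫ x in M, u x * oddPart R v x ∂riemannianVolume X := by
      have h4 := congrArg (fun a : 𝕜 => (√2)⁻¹ • a) h2
      simp only [smul_smul] at h4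
      rwa [inv_mul_cancel₀ (by positivity), one_smul, ← div_eq_inv_mul, Real.div_sqrt] at h4
    rw [h3, enorm_smul, hsqrt]
    gcongr
    exact le_iSup₂_of_le (oddPart R v) N' (le_iSup₂_of_le hv' (hN'.trans hN) le_rfl)
  · rw [borderedHNegOneNorm, dualNorm]
    simp_rw [ENNReal.mul_iSup]
    refine iSup_le fun v => iSup_le fun N => iSup_le fun hv => iSup_le fun hN => ?_
    -- The function `v` is controlled only on `M`; its values elsewhere are replaced by zero before
    -- the odd part is taken.
    have hvM : MemLp (M.indicator v) 2 (riemannianVolume X) :=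
      (memLp_indicator_iff_restrict hM).2 hv.1
    have h1 := integral_mul_oddPart hdouble.measurePreserving hdouble.involutive hum hvM hodd
    have h2 : ∫ x, u x * M.indicator v x ∂riemannianVolume X
        = ∫ x in M, u x * v x ∂riemannianVolume X := by
      rw [← integral_indicator hM]
      refine integral_congr_ae (Eventually.of_forall fun x => ?_)
      by_cases hx : x ∈ M <;> simp [hx]
    rw [hsqrt, ← enorm_smul, ← h2, ← h1]
    refine le_iSup₂_of_le (oddPart R (M.indicator v)) N
      (le_iSup₂_of_le (hdouble.hasH1Norm_oddPart_indicator hv) hN ?_)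
    rw [Measure.restrict_univ]

end Double

end DoubledSurface

end

/-- `X` is the double of the bordered Riemann surface `M`, with reflection `R`, and `u` is a smooth
function on `X`, odd under `R`, with values in `𝕜 = ℝ` or `ℂ`. -/
theorem lemma3p5 {𝕜 : Type*} [RCLike 𝕜]
    {X : Type*} [TopologicalSpace X] [T2Space X] [CompactSpace X]
    [MeasurableSpace X] [BorelSpace X]
    [ChartedSpace ℂ X] [IsManifold 𝓘(ℂ, ℂ) ω X]
    [RiemannianBundle (fun x : X => TangentSpace 𝓘(ℝ, ℂ) x)]
    [IsContMDiffRiemannianBundle 𝓘(ℝ, ℂ) ∞ ℂ (fun x : X => TangentSpace 𝓘(ℝ, ℂ) x)]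
    (hconf : DoubledSurface.IsConformalMetric X)
    (M : Set X) (R : X → X) (hdouble : DoubledSurface.IsDouble M R)
    (h : ℝ) (hh : 0 < h)
    (u : X → 𝕜) (hu : ContMDiff 𝓘(ℝ, ℂ) 𝓘(ℝ, 𝕜) ∞ u) (hodd : ∀ x, u (R x) = -u x) :
    DoubledSurface.closedHNegOneNorm h u ≠ ⊤ ∧
    DoubledSurface.closedHNegOneNorm h u
      = ENNReal.ofReal (√2) * DoubledSurface.borderedHNegOneNorm h M u :=
  ⟨DoubledSurface.closedHNegOneNorm_ne_top h hu,
    hdouble.closedHNegOneNorm_eq h hu hodd⟩
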